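/- Let $N\ge 1$ be an integer and $p\in[1,\infty)$. For $t>0$ let $\mathsf h_t(x)=(4\pi t)^{-N/2}e^{-|x|^2/(4t)}$, $x\in\mathbb R^N$, and $\mathsf H_t f=\mathsf h_t*f$. Let $\mathcal S^p(\mathbb R^N)=W^{1,p}(\mathbb R^N)$ and $\|Du\|_{L^p}^p=\int_{\mathbb R^N}|Du|^p\,dx$ if $p>1$, and $\mathcal S^1(\mathbb R^N)=BV(\mathbb R^N)$ and $\|Du\|_{L^1}=|Du|(\mathbb R^N)$ (the total variation) if $p=1$, where all functions are real-valued and $Du$ is the distributional gradient. For $u\in L^p(\mathbb R^N)$ and $t>0$ set $$E_t(u)=t^{-\frac p2}\int_{\mathbb R^N}\mathsf H_t\big(|u-u(x)|^p\big)(x)\,dx\in[0,\infty],\qquad E_0(u)=\frac{2\,\Gamma(p)}{\Gamma(p/2)}\,\|Du\|_{L^p}^p .$$ 1. (Pointwise limit.) $\lim_{t\to0^+}E_t(u)=E_0(u)$ for every $u\in\mathcal S^p(\mathbb R^N)$. Moreover, for every sequence $(t_k)_{k\in\mathbb N}\subset(0,1)$ with $t_k\to0$ the following hold. 2. ($\Gamma$-limit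 in the $L^p$ topology.) If $(u_k)\subset L^p(\mathbb R^N)$ and $u_k\to u$ in $L^p(\mathbb R^N)$ for some $u\in\mathcal S^p(\mathbb R^N)$, then $\liminf_{k}E_{t_k}(u_k)\ge E_0(u)$; and for every $u\in\mathcal S^p(\mathbb R^N)$ there is $(u_k)\subset\mathcal S^p(\mathbb R^N)$ with $u_k\to u$ in $L^p(\mathbb R^N)$ and $\limsup_{k}E_{t_k}(u_k)\le E_0(u)$. 3. (Coerciveness.) If $(u_k)\subset L^p(\mathbb R^N)$, $u_k\to u$ in $L^p(\mathbb R^N)$ for some $u\in L^p(\mathbb R^N)$, and $\liminf_k E_{t_k}(u_k)<\infty$, then $u\in\mathcal S^p(\mathbb R^N)$. 4. (Compactness.) If $(u_k)\subset L^p(\mathbb R^N)$ and $\sup_{k}\big(\|u_k\|_{L^p}+E_{t_k}(u_k)\big)<\infty$, then $(u_k)$ is locally precompact in $L^p(\mathbb R^N)$, that is, $\{u_k:k\in\mathbb N\}$ is precompact in $L^p(K)$ for every compact $K\subset\mathbb R^N$, and every $L^p_{\rm loc}(\mathbb R^N)$ limit of a subsequence of $(u_k)$ belongs to $\mathcal S^p(\mathbb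 R^N)$. If only $\liminf_{k}\big(\|u_k\|_{L^p}+E_{t_k}(u_k)\big)<\infty$, then the same conclusion holds for some subsequence of $(u_k)$. -/

import Mathlib

open MeasureTheory Filter Topology
open scoped ENNReal ContDiff

noncomputable section

namespace HeatEnergy

/-- The space `ℝ^N` with its Euclidean norm. -/
abbrev Eucl (N : ℕ) : Type := EuclideanSpace ℝ (Fin N)

variable {N : ℕ}

/-! ### The heat semigroup and the heat energies -/

/-- The heat kernel `h_t(x) = (4πt)^{-N/2} exp(-|x|²/(4t))`. -/
def heatKernel (t : ℝ) (x : Eucl N) : ℝ :=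
  Real.exp (-‖x‖ ^ 2 / (4 * t)) / (4 * Real.pi * t) ^ ((N : ℝ) / 2)

/-- The heat semigroup `H_t f = h_t * f` on non-negative measurable functions. -/
def heatSemigroup (t : ℝ) (f : Eucl N → ℝ≥0∞) (x : Eucl N) : ℝ≥0∞ :=
  ∫⁻ y, ENNReal.ofReal (heatKernel t (x - y)) * f y

/-- The heat energy `t^{-p/2} ∫ H_t(|u - u(x)|^p)(x) dx`. -/
def heatEnergy (p t : ℝ) (u : Eucl N → ℝ) : ℝ≥0∞ :=
  ENNReal.ofReal (t ^ (-(p / 2))) * ∫⁻ x, heatSemigroup t (fun y => ‖u y - u x‖ₑ ^ p) x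

/-! ### Sobolev and BV functions -/

/-- `G` is the distributional gradient of `u`, and `u`, `G` are locally integrable:
`∫ u ∂ᵢφ = - ∫ Gᵢ φ` for every test function `φ` and every `i`. -/
def IsWeakGradient (u : Eucl N → ℝ) (G : Eucl N → Eucl N) : Prop :=
  LocallyIntegrable u volume ∧ LocallyIntegrable G volume ∧
    ∀ φ : Eucl N → ℝ, ContDiff ℝ ∞ φ → HasCompactSupport φ → ∀ i : Fin N,
      ∫ x, u x * fderiv ℝ φ x (EuclideanSpace.single i 1) = - ∫ x, G x i * φ x

/-- The divergence of a vector field on `ℝ^N`. -/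
def divergence (φ : Eucl N → Eucl N) (x : Eucl N) : ℝ :=
  ∑ i : Fin N, fderiv ℝ φ x (EuclideanSpace.single i 1) i

/-- The total variation `|Du|(ℝ^N)` of the distributional gradient of `u`: the supremum of
`∫ u div φ` over the smooth compactly supported vector fields `φ` with `|φ| ≤ 1` (Euclidean
norm). -/
def totalVariation (u : Eucl N → ℝ) : ℝ≥0∞ :=
  ⨆ φ ∈ {φ : Eucl N → Eucl N | ContDiff ℝ ∞ φ ∧ HasCompactSupport φ ∧ ∀ x, ‖φ x‖ ≤ 1},
    ENNReal.ofReal (∫ x, u x * divergence φ x)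

/-- The space `W^{1,p}(ℝ^N)`. -/
def sobolevSpace (N : ℕ) (p : ℝ) : Set (Eucl N → ℝ) :=
  {u | MemLp u (ENNReal.ofReal p) volume ∧
    ∃ G : Eucl N → Eucl N, IsWeakGradient u G ∧ MemLp G (ENNReal.ofReal p) volume}

/-- The space `BV(ℝ^N)`. -/
def bvSpace (N : ℕ) : Set (Eucl N → ℝ) :=
  {u | MemLp u 1 volume ∧ totalVariation u < ⊤}

/-- The space `S^p(ℝ^N)`: `W^{1,p}(ℝ^N)` for `p > 1` and `BV(ℝ^N)` for `p = 1`. -/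
def sobBV (N : ℕ) (p : ℝ) : Set (Eucl N → ℝ) :=
  if p = 1 then bvSpace N else sobolevSpace N p

/-- The Dirichlet energy `‖Du‖_{L^p}^p`: it is `∫ |Du|^p` for `p > 1`, and `|Du|(ℝ^N)` for `p = 1`.
The weak gradient is unique up to null sets, so the infimum is the value at the weak gradient
of `u` (and `⊤` if `u` has none). -/
def gradEnergy (p : ℝ) (u : Eucl N → ℝ) : ℝ≥0∞ :=
  if p = 1 then totalVariation u
  else ⨅ G ∈ {G : Eucl N → Eucl N | IsWeakGradient u G}, ∫⁻ x, ‖G x‖ₑ ^ p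

/-! ### Convergence in `L^p` and convergence of functionals -/

/-- Convergence `u_k → v` in `L^p(ℝ^N)` (for functions in `L^p`). -/
def TendstoLp (p : ℝ) (u : ℕ → Eucl N → ℝ) (v : Eucl N → ℝ) : Prop :=
  Tendsto (fun k => eLpNorm (u k - v) (ENNReal.ofReal p) volume) atTop (𝓝 0)

/-- `v` belongs to `L^p_loc(ℝ^N)` and `u_k → v` in `L^p_loc(ℝ^N)`. -/
def TendstoLpLoc (p : ℝ) (u : ℕ → Eucl N → ℝ) (v : Eucl N → ℝ) : Prop :=
  ∀ K : Set (Eucl N), IsCompact K →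
    MemLp v (ENNReal.ofReal p) (volume.restrict K) ∧
    Tendsto (fun k => eLpNorm (u k - v) (ENNReal.ofReal p) (volume.restrict K)) atTop (𝓝 0)

/-- `Γ`-convergence of `F_k` to `G` on `𝒳 ⊆ L^p(ℝ^N)` with respect to the `L^p` topology. -/
def GammaConvergesOn (p : ℝ) (𝒳 : Set (Eucl N → ℝ)) (F : ℕ → (Eucl N → ℝ) → ℝ≥0∞)
    (G : (Eucl N → ℝ) → ℝ≥0∞) : Prop :=
  (∀ (u : ℕ → Eucl N → ℝ) (v : Eucl N → ℝ), (∀ k, MemLp (u k) (ENNReal.ofReal p) volume) →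
      v ∈ 𝒳 → TendstoLp p u v → G v ≤ liminf (fun k => F k (u k)) atTop) ∧
  (∀ v ∈ 𝒳, ∃ u : ℕ → Eucl N → ℝ, (∀ k, u k ∈ 𝒳) ∧ TendstoLp p u v ∧
      limsup (fun k => F k (u k)) atTop ≤ G v)

/-- Coerciveness of `F_k` on `𝒳 ⊆ L^p(ℝ^N)`. -/
def CoerciveOn (p : ℝ) (𝒳 : Set (Eucl N → ℝ)) (F : ℕ → (Eucl N → ℝ) → ℝ≥0∞) : Prop :=
  ∀ (u : ℕ → Eucl N → ℝ) (v : Eucl N → ℝ), (∀ k, MemLp (u k) (ENNReal.ofReal p) volume) →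
    MemLp v (ENNReal.ofReal p) volume → TendstoLp p u v →
    liminf (fun k => F k (u k)) atTop < ⊤ → v ∈ 𝒳

/-- Local precompactness in `L^p(ℝ^N)`: for every compact `K`, the set `𝒳` is precompact in the
metric space `L^p(K)`, i.e. every sequence in `𝒳` has a subsequence converging in `L^p(K)`. -/
def LocallyPrecompact (p : ℝ) (𝒳 : Set (Eucl N → ℝ)) : Prop :=
  ∀ K : Set (Eucl N), IsCompact K → ∀ w : ℕ → Eucl N → ℝ, (∀ j, w j ∈ 𝒳) →
    ∃ φ : ℕ → ℕ, StrictMono φ ∧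
      ∃ v : Eucl N → ℝ, MemLp v (ENNReal.ofReal p) (volume.restrict K) ∧
        Tendsto (fun j => eLpNorm (w (φ j) - v) (ENNReal.ofReal p) (volume.restrict K))
          atTop (𝓝 0)

/-- `(u_k)` is locally precompact in `L^p(ℝ^N)`, and every `L^p_loc(ℝ^N)` limit of a subsequence
of `(u_k)` belongs to `𝒳`. -/
def LocallyPrecompactWithLimitsIn (p : ℝ) (𝒳 : Set (Eucl N → ℝ)) (u : ℕ → Eucl N → ℝ) : Prop :=
  LocallyPrecompact p (Set.range u) ∧
    ∀ (φ : ℕ → ℕ) (v : Eucl N → ℝ), StrictMono φ → TendstoLpLoc p (fun j => u (φ j)) v → v ∈ 𝒳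

/-- An infinitesimal sequence in `(0,1)`. -/
def Infinitesimal (t : ℕ → ℝ) : Prop :=
  (∀ k, t k ∈ Set.Ioo (0 : ℝ) 1) ∧ Tendsto t atTop (𝓝 0)

end HeatEnergy

end

open HeatEnergy

noncomputable section

namespace HeatEnergy

variable {N : ℕ}

/-! ### Rescaled form and monotonicity of the heat energies -/

/-! By Tonelli, `E_t(u)` is `t^{-p/2}` times the average, with weight `h_t(h)`, of the translation
energies `‖u(· + h) - u‖_p^p`. Three properties of this form carry the proof; `c` denotes
`2Γ(p)/Γ(p/2)`, the `p`-th absolute moment of `h_1` in any unit direction.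

Monotonicity: by Minkowski, the translation energy at `m h` is at most `m^p` times that at `h`, so
`E_{m² t} ≤ E_t` for integers `m ≥ 1` (`heatEnergy_sq_mul_le`). If `t_k → 0`, integers with `m_k²
t_k → s` exist for every fixed `s > 0`, and Fatou yields `E_s(v) ≤ liminf E_{t_k}(u_k)` when `u_k →
v` in `L^p_loc` (`heatEnergy_le_liminf`).

Identification of the supremum: for smooth `w`, the fundamental theorem of calculus gives `E_t(w) ≤
c ∫ |∇w|^p`, and Fatou as `t → 0` shows that any common bound of the `E_t(w)` also bounds `c ∫
|∇w|^p`. Mollification increases neither the heat energies nor the Dirichlet energy, so both facts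
extend to general `u`: `E_t ≤ E_0` on `S^p` (`heatEnergy_le_gradEnergy`), and `E_s(u) ≤ a < ∞` for
all `s > 0` forces `u ∈ S^p` and `E_0(u) ≤ a` (`mem_sobBV_and_gradEnergy_le`). The limit of the
smooth approximations is handled by duality for `p = 1`; for `p > 1`, uniform convexity makes the
gradients of a minimising sequence converge strongly. The pointwise limit, the `Γ`-limit (with
constant recovery sequences) and coerciveness follow.

Compactness: a mollifier at scale `r` is dominated by the heat kernel at times comparable to `r²`,
so the mollification error is at most a constant times `r E_s(u)^{1/p}`. By monotonicity this is
uniform along the tail of the sequence, and the mollified functions are equibounded and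
equi-Lipschitz on compact sets (`totallyBounded_range_toLp`). -/

lemma heatKernel_nonneg (t : ℝ) (ht : 0 ≤ t) (x : Eucl N) : 0 ≤ heatKernel t x := by
  unfold heatKernel; positivity

lemma heatKernel_pos (t : ℝ) (ht : 0 < t) (x : Eucl N) : 0 < heatKernel t x := by
  unfold heatKernel; positivity

lemma continuous_heatKernel (t : ℝ) : Continuous (heatKernel (N := N) t) := by
  unfold heatKernel; fun_prop

@[fun_prop]
lemma measurable_heatKernel (t : ℝ) : Measurable (heatKernel (N := N) t) :=
  (continuous_heatKernel t).measurable

lemma heatKernel_neg (t : ℝ) (x : Eucl N) : heatKernel t (-x) = heatKernel t x := by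
  simp [heatKernel]

lemma heatKernel_smul_sqrt {t : ℝ} (ht : 0 < t) (x : Eucl N) :
    √t ^ N * heatKernel t (√t • x) = heatKernel 1 x := by
  unfold heatKernel
  have h1 : (4 * Real.pi * t) ^ ((N : ℝ) / 2) = (4 * Real.pi * 1) ^ ((N : ℝ) / 2) * √t ^ N := by
    rw [Real.mul_rpow (by positivity) ht.le, Real.sqrt_eq_rpow, ← Real.rpow_mul_natCast ht.le,
      mul_one]
    congr 2; ring
  have h2 : -‖√t • x‖ ^ 2 / (4 * t) = -‖x‖ ^ 2 / (4 * 1) := by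
    rw [norm_smul, mul_pow, Real.norm_eq_abs, sq_abs, Real.sq_sqrt ht.le]
    field_simp
  rw [h1, h2]
  have : 0 < √t ^ N := by positivity
  have : 0 < (4 * Real.pi * 1) ^ ((N : ℝ) / 2) := by positivity
  field_simp

lemma lintegral_comp_smul_pos {r : ℝ} (hr : 0 < r) {f : Eucl N → ℝ≥0∞} (hf : Measurable f) :
    ENNReal.ofReal (r ^ N) * ∫⁻ x, f (r • x) = ∫⁻ x, f x := by
  have h := lintegral_map (μ := (volume : Measure (Eucl N))) hf (measurable_const_smul r)
  rw [← h, Measure.map_addHaar_smul _ hr.ne', lintegral_smul_measure, smul_eq_mul, ← mul_assoc,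
    finrank_euclideanSpace_fin, ← ENNReal.ofReal_mul (by positivity), abs_of_pos (by positivity),
    mul_inv_cancel₀ (by positivity), ENNReal.ofReal_one, one_mul]

lemma lintegral_heatKernel_mul {t : ℝ} (ht : 0 < t) {f : Eucl N → ℝ≥0∞} (hf : Measurable f) :
    ∫⁻ h, ENNReal.ofReal (heatKernel t h) * f h =
      ∫⁻ z, ENNReal.ofReal (heatKernel 1 z) * f (√t • z) := by
  have hs : 0 < √t := Real.sqrt_pos.2 ht
  rw [← lintegral_comp_smul_pos hs (by fun_prop), ← lintegral_const_mul _ (by fun_prop)]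
  congr with z
  rw [← mul_assoc, ← ENNReal.ofReal_mul (by positivity), heatKernel_smul_sqrt ht]

/-- The `p`-th power of the `L^p` norm of the increment `u (· + h) - u`. -/
def translationEnergy (p : ℝ) (u : Eucl N → ℝ) (h : Eucl N) : ℝ≥0∞ :=
  ∫⁻ x, ‖u (x + h) - u x‖ₑ ^ p

lemma measurable_translationEnergy (p : ℝ) {u : Eucl N → ℝ} (hu : Measurable u) :
    Measurable (translationEnergy p u) := by
  unfold translationEnergy
  refine Measurable.lintegral_prod_right' (f := fun q : Eucl N × Eucl N =>
    ‖u (q.2 + q.1) - u q.2‖ₑ ^ p) ?_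
  fun_prop

lemma heatEnergy_eq (p t : ℝ) {u : Eucl N → ℝ} (hu : Measurable u) :
    heatEnergy p t u = ENNReal.ofReal (t ^ (-(p / 2))) *
      ∫⁻ h, ENNReal.ofReal (heatKernel t h) * translationEnergy p u h := by
  unfold heatEnergy heatSemigroup translationEnergy
  congr 1
  have h1 : ∀ x, ∫⁻ y, ENNReal.ofReal (heatKernel t (x - y)) * ‖u y - u x‖ₑ ^ p =
      ∫⁻ h, ENNReal.ofReal (heatKernel t h) * ‖u (x + h) - u x‖ₑ ^ p := fun x => by
    rw [← lintegral_add_left_eq_self _ x]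
    congr with h
    rw [← heatKernel_neg]; simp
  simp_rw [h1]
  rw [lintegral_lintegral_swap]
  · congr with h
    rw [lintegral_const_mul _ (by fun_prop)]
  · have : Measurable (Function.uncurry fun x h : Eucl N =>
      ENNReal.ofReal (heatKernel t h) * ‖u (x + h) - u x‖ₑ ^ p) := by
      unfold Function.uncurry; fun_prop
    exact this.aemeasurable

lemma heatEnergy_eq_rescaled (p : ℝ) {t : ℝ} (ht : 0 < t) {u : Eucl N → ℝ} (hu : Measurable u) :
    heatEnergy p t u = ENNReal.ofReal (t ^ (-(p / 2))) *
      ∫⁻ z, ENNReal.ofReal (heatKernel 1 z) * translationEnergy p u (√t • z) := by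
  rw [heatEnergy_eq p t hu, lintegral_heatKernel_mul ht (measurable_translationEnergy p hu)]

lemma heatEnergy_congr_ae (p t : ℝ) {u v : Eucl N → ℝ} (h : u =ᵐ[volume] v) :
    heatEnergy p t u = heatEnergy p t v := by
  unfold heatEnergy heatSemigroup
  congr 1
  refine lintegral_congr_ae ?_
  filter_upwards [h] with x hx
  refine lintegral_congr_ae ?_
  filter_upwards [h] with y hy
  rw [hx, hy]

lemma translationEnergy_eq_eLpNorm {p : ℝ} (hp : 1 ≤ p) (u : Eucl N → ℝ) (h : Eucl N) :
    translationEnergy p u h = eLpNorm (fun x => u (x + h) - u x) (ENNReal.ofReal p) volume ^ p := by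
  have hp0 : 0 < p := by linarith
  rw [eLpNorm_eq_lintegral_rpow_enorm_toReal (by simpa using hp0) (by simp),
    ENNReal.toReal_ofReal hp0.le, ← ENNReal.rpow_mul, one_div, inv_mul_cancel₀ hp0.ne',
    ENNReal.rpow_one, translationEnergy]

/-- The increment over `m h` telescopes into `m` translates of the increment over `h`, all with the
same norm; Minkowski, hence `1 ≤ p`, gives the factor `m`. -/
lemma translationEnergy_natCast_smul_le {p : ℝ} (hp : 1 ≤ p) {u : Eucl N → ℝ} (hu : Measurable u)
    (m : ℕ) (h : Eucl N) :
    translationEnergy p u ((m : ℝ) • h) ≤ (m : ℝ≥0∞) ^ p * translationEnergy p u h := by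
  have hp0 : 0 < p := by linarith
  simp_rw [translationEnergy_eq_eLpNorm hp, ← ENNReal.mul_rpow_of_nonneg _ _ hp0.le]
  gcongr
  induction m with
  | zero => simp
  | succ m ih =>
    set P := ENNReal.ofReal p
    have hP : 1 ≤ P := by simpa [P] using hp
    have h1 : eLpNorm (fun x => u (x + h + (m : ℝ) • h) - u (x + h)) P volume =
        eLpNorm (fun x => u (x + (m : ℝ) • h) - u x) P volume :=
      eLpNorm_comp_measurePreserving (g := fun x => u (x + (m : ℝ) • h) - u x)
        (by fun_prop) (measurePreserving_add_right volume h)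
    have h2 : (fun x => u (x + ((m + 1 : ℕ) : ℝ) • h) - u x) =
        (fun x => u (x + h + (m : ℝ) • h) - u (x + h)) + fun x => u (x + h) - u x := by
      ext x
      have : x + ((m + 1 : ℕ) : ℝ) • h = x + h + (m : ℝ) • h := by push_cast; module
      simp only [Pi.add_apply]; rw [this]; ring
    rw [h2]
    refine (eLpNorm_add_le (by fun_prop) (by fun_prop) hP).trans ?_
    rw [h1, Nat.cast_add, add_mul, Nat.cast_one, one_mul]
    gcongr

/-- The factor `m^p` from the translation energies cancels `(m²)^{-p/2}` exactly. This substitute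
for monotonicity in time suffices, because the values `m² t` become dense as `t → 0`. -/
lemma heatEnergy_sq_mul_le {p : ℝ} (hp : 1 ≤ p) {u : Eucl N → ℝ} (hu : Measurable u) {t : ℝ}
    (ht : 0 < t) {m : ℕ} (hm : 0 < m) :
    heatEnergy p ((m : ℝ) ^ 2 * t) u ≤ heatEnergy p t u := by
  have hm' : (0 : ℝ) < m := by exact_mod_cast hm
  have hp0 : 0 < p := by linarith
  rw [heatEnergy_eq_rescaled p (by positivity) hu, heatEnergy_eq_rescaled p ht hu]
  have h1 : ENNReal.ofReal (((m : ℝ) ^ 2 * t) ^ (-(p / 2))) * (m : ℝ≥0∞) ^ p =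
      ENNReal.ofReal (t ^ (-(p / 2))) := by
    rw [← ENNReal.ofReal_natCast, ENNReal.ofReal_rpow_of_pos hm',
      ← ENNReal.ofReal_mul (by positivity), Real.mul_rpow (by positivity) ht.le,
      ← Real.rpow_natCast, ← Real.rpow_mul hm'.le, mul_right_comm, ← Real.rpow_add hm']
    norm_num
    rw [show -(2 * (p / 2)) + p = 0 by ring]; simp
  rw [← h1, mul_assoc]
  refine mul_le_mul' le_rfl ?_
  rw [← lintegral_const_mul _ (by
    have := (measurable_translationEnergy p hu); fun_prop)]
  refine lintegral_mono fun z => ?_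
  rw [Real.sqrt_mul (by positivity), Real.sqrt_sq hm'.le, mul_smul, mul_left_comm]
  gcongr
  exact translationEnergy_natCast_smul_le hp hu m _

/-! ### Lower semicontinuity along a.e. convergent sequences -/

/-- Fatou in `y` and then in `x`. The time is allowed to vary, since only approximations `m_k² t_k`
of a given time are available. -/
lemma heatEnergy_le_of_ae_tendsto {p : ℝ} (hp : 1 ≤ p) {u : ℕ → Eucl N → ℝ} {v : Eucl N → ℝ}
    (hu : ∀ k, Measurable (u k)) (huv : ∀ᵐ x, Tendsto (fun k => u k x) atTop (𝓝 (v x)))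
    {s : ℕ → ℝ} {s₀ : ℝ} (hs₀ : 0 < s₀) (hs : Tendsto s atTop (𝓝 s₀)) {a : ℝ≥0∞}
    (ha : ∀ᶠ k in atTop, heatEnergy p (s k) (u k) ≤ a) : heatEnergy p s₀ v ≤ a := by
  have hp0 : 0 < p := by linarith
  set F : ℕ → Eucl N → Eucl N → ℝ≥0∞ := fun k x y => ENNReal.ofReal ((s k) ^ (-(p / 2))) *
    (ENNReal.ofReal (heatKernel (s k) (x - y)) * ‖u k y - u k x‖ₑ ^ p) with hF
  have hFm : ∀ k, Measurable (Function.uncurry (F k)) := fun k => by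
    have := hu k
    simp only [hF, Function.uncurry_def]; fun_prop
  have hE : ∀ k, heatEnergy p (s k) (u k) = ∫⁻ x, ∫⁻ y, F k x y := fun k => by
    have := hu k
    simp only [heatEnergy, heatSemigroup, hF]
    rw [← lintegral_const_mul']
    · congr with x
      rw [← lintegral_const_mul' _ _ (by simp)]
    · simp
  have h1 : heatEnergy p s₀ v ≤ ∫⁻ x, ∫⁻ y, liminf (fun k => F k x y) atTop := by
    simp only [heatEnergy, heatSemigroup]
    rw [← lintegral_const_mul' _ _ (by simp)]
    refine lintegral_mono_ae ?_
    filter_upwards [huv] with x hx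
    rw [← lintegral_const_mul' _ _ (by simp)]
    refine lintegral_mono_ae ?_
    filter_upwards [huv] with y hy
    refine le_of_eq (Tendsto.liminf_eq ?_).symm
    simp only [hF]
    -- A product in `ℝ≥0∞` may fail to converge only when the limits are `0` and `∞`; here the
    -- prefactors have positive finite limits.
    refine ENNReal.Tendsto.mul (ENNReal.tendsto_ofReal (hs.rpow_const (Or.inl hs₀.ne')))
      (Or.inl ?_) (ENNReal.Tendsto.mul (ENNReal.tendsto_ofReal ?_) (Or.inl ?_)
      (((hy.sub hx).enorm).ennrpow_const p) (Or.inr (by simp))) (Or.inr ?_)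
    · simp [Real.rpow_pos_of_pos hs₀]
    · unfold heatKernel
      refine Tendsto.div ?_ ?_ (by positivity)
      · refine (Real.continuous_exp.tendsto _).comp ?_
        exact tendsto_const_nhds.div (hs.const_mul 4) (by positivity)
      · exact (hs.const_mul _).rpow_const (Or.inr (by positivity))
    · simp [heatKernel_pos s₀ hs₀]
    · exact ENNReal.ofReal_ne_top
  refine h1.trans ?_
  calc ∫⁻ x, ∫⁻ y, liminf (fun k => F k x y) atTop
      ≤ ∫⁻ x, liminf (fun k => ∫⁻ y, F k x y) atTop :=
        lintegral_mono fun x => lintegral_liminf_le fun k => (hFm k).of_uncurry_left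
    _ ≤ liminf (fun k => ∫⁻ x, ∫⁻ y, F k x y) atTop :=
        lintegral_liminf_le fun k => (hFm k).lintegral_prod_right'
    _ ≤ a := by
        simp_rw [← hE]
        exact liminf_le_of_frequently_le' ha.frequently

/-- An integer multiple `m` of a small step such that `m² t_k` approximates a given time. -/
lemma tendsto_floor_sqrt_sq_mul {t : ℕ → ℝ} (ht : ∀ k, 0 < t k) (ht0 : Tendsto t atTop (𝓝 0))
    {s : ℝ} (hs : 0 < s) :
    (∀ᶠ k in atTop, 0 < ⌊√(s / t k)⌋₊) ∧
      Tendsto (fun k => (⌊√(s / t k)⌋₊ : ℝ) ^ 2 * t k) atTop (𝓝 s) := by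
  have h1 : Tendsto (fun k => √(s / t k)) atTop atTop := by
    refine Real.tendsto_sqrt_atTop.comp ?_
    refine Tendsto.const_mul_atTop hs (tendsto_inv_nhdsGT_zero.comp ?_)
    exact tendsto_nhdsWithin_iff.2 ⟨ht0, Eventually.of_forall ht⟩
  refine ⟨?_, ?_⟩
  · filter_upwards [h1.eventually_ge_atTop 1] with k hk
    exact Nat.floor_pos.2 hk
  · have h2 := (tendsto_nat_floor_div_atTop (R := ℝ)).comp h1
    have h3 := (h2.pow 2).mul_const s
    simp only [one_pow, one_mul] at h3
    refine h3.congr fun k => ?_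
    have : √(s / t k) ^ 2 = s / t k := Real.sq_sqrt (div_nonneg hs.le (ht k).le)
    simp only [Function.comp_apply, div_pow, this]
    have := ht k
    field_simp

lemma heatEnergy_le_of_ae_tendsto_of_tendsto_zero {p : ℝ} (hp : 1 ≤ p) {u : ℕ → Eucl N → ℝ}
    {v : Eucl N → ℝ} (hu : ∀ k, Measurable (u k))
    (huv : ∀ᵐ x, Tendsto (fun k => u k x) atTop (𝓝 (v x))) {t : ℕ → ℝ} (ht : ∀ k, 0 < t k)
    (ht0 : Tendsto t atTop (𝓝 0)) {a : ℝ≥0∞} (ha : ∀ k, heatEnergy p (t k) (u k) ≤ a) {s : ℝ}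
    (hs : 0 < s) : heatEnergy p s v ≤ a := by
  obtain ⟨h1, h2⟩ := tendsto_floor_sqrt_sq_mul ht ht0 hs
  refine heatEnergy_le_of_ae_tendsto hp hu huv hs h2 ?_
  filter_upwards [h1] with k hk
  exact (heatEnergy_sq_mul_le hp (hu k) (ht k) hk).trans (ha k)

/-! ### Moments of the Gaussian -/

lemma integral_heatWeight :
    ∫ s : ℝ, Real.exp (-(1 / 4) * s ^ 2) / √(4 * Real.pi) = 1 := by
  rw [integral_div, integral_gaussian, div_eq_one_iff_eq (by positivity)]
  congr 1; ring

/-- The Gaussian moment is a multiple of `Γ((p+1)/2)/√π`; Legendre's duplication formula at `p/2`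
rewrites it as a quotient of `Γ(p)` and `Γ(p/2)`. -/
lemma integral_heatWeight_mul_abs_rpow {p : ℝ} (hp : 1 ≤ p) :
    ∫ s : ℝ, Real.exp (-(1 / 4) * s ^ 2) / √(4 * Real.pi) * |s| ^ p =
      2 * Real.Gamma p / Real.Gamma (p / 2) := by
  have h1 : ∫ s : ℝ, Real.exp (-(1 / 4) * s ^ 2) / √(4 * Real.pi) * |s| ^ p =
      (√(4 * Real.pi))⁻¹ *
        ∫ s : ℝ, (fun r : ℝ => r ^ p * Real.exp (-(1 / 4) * r ^ (2 : ℝ))) |s| := by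
    rw [← integral_const_mul]
    congr with s
    simp only [Real.rpow_two, sq_abs]; ring
  rw [h1, integral_comp_abs (f := fun r : ℝ => r ^ p * Real.exp (-(1 / 4) * r ^ (2 : ℝ))),
    integral_rpow_mul_exp_neg_mul_rpow (by norm_num) (by linarith) (by norm_num)]
  have hG := Real.Gamma_mul_Gamma_add_half (p / 2)
  have hpos : 0 < Real.Gamma (p / 2) := Real.Gamma_pos_of_pos (by linarith)
  have h4 : ((1 : ℝ) / 4) ^ (-(p + 1) / 2) = 2 ^ p * 2 := by
    rw [show (1 : ℝ) / 4 = 2 ^ (-2 : ℝ) by rw [Real.rpow_neg (by norm_num)]; norm_num,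
      ← Real.rpow_mul (by norm_num), show (-2 : ℝ) * (-(p + 1) / 2) = p + 1 by ring,
      Real.rpow_add (by norm_num), Real.rpow_one]
  have h5 : √(4 * Real.pi) = 2 * √Real.pi := by
    rw [Real.sqrt_mul (by norm_num), show (4 : ℝ) = 2 ^ 2 by norm_num, Real.sqrt_sq (by norm_num)]
  have h6 : (2 : ℝ) ^ (1 - 2 * (p / 2)) = 2 / 2 ^ p := by
    rw [Real.rpow_sub (by norm_num), Real.rpow_one]; ring_nf
  have h7 : (p + 1) / 2 = p / 2 + 1 / 2 := by ring
  have h8 : 2 * (p / 2) = p := by ring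
  rw [h6, h8] at hG
  rw [h4, h5, h7, eq_div_iff hpos.ne']
  have h9 : 0 < √Real.pi := Real.sqrt_pos.2 Real.pi_pos
  have h10 : (0 : ℝ) < 2 ^ p := by positivity
  calc _ = (√Real.pi)⁻¹ * 2 ^ p * (Real.Gamma (p / 2) * Real.Gamma (p / 2 + 1 / 2)) := by
        field_simp
    _ = _ := by rw [hG]; field_simp

lemma gaussianConst_pos {p : ℝ} (hp : 1 ≤ p) : 0 < 2 * Real.Gamma p / Real.Gamma (p / 2) := by
  have h1 : 0 < Real.Gamma (p / 2) := Real.Gamma_pos_of_pos (by linarith)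
  have h2 : 0 < Real.Gamma p := Real.Gamma_pos_of_pos (by linarith)
  positivity

lemma heatKernel_one_eq_prod (y : Eucl N) :
    heatKernel 1 y = ∏ i, Real.exp (-(1 / 4) * y i ^ 2) / √(4 * Real.pi) := by
  unfold heatKernel
  rw [Finset.prod_div_distrib, ← Real.exp_sum, EuclideanSpace.norm_sq_eq]
  congr 1
  · congr 1
    rw [← Finset.mul_sum]; simp only [Real.norm_eq_abs, sq_abs]; ring
  · simp only [Finset.prod_const, Finset.card_univ, Fintype.card_fin]
    rw [Real.sqrt_eq_rpow, ← Real.rpow_mul_natCast (by positivity)]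
    congr 1 <;> ring

lemma lintegral_heatKernel_mul_coord {p : ℝ} (hp : 1 ≤ p) (i₀ : Fin N) :
    ∫⁻ y : Eucl N, ENNReal.ofReal (heatKernel 1 y) * ‖y i₀‖ₑ ^ p =
      ENNReal.ofReal (2 * Real.Gamma p / Real.Gamma (p / 2)) := by
  have hp0 : 0 < p := by linarith
  let φ : Fin N → ℝ → ℝ := fun i s =>
    Real.exp (-(1 / 4) * s ^ 2) / √(4 * Real.pi) * (if i = i₀ then |s| ^ p else 1)
  have hφ : ∀ i, ∫ s, φ i s = if i = i₀ then 2 * Real.Gamma p / Real.Gamma (p / 2) else 1 := by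
    intro i
    by_cases h : i = i₀
    · simp only [φ, h, if_true, integral_heatWeight_mul_abs_rpow hp]
    · simp only [φ, h, if_false, mul_one, integral_heatWeight]
  have hφi : ∀ i, Integrable (φ i) := fun i => by
    -- The Bochner integral of a non-integrable function is `0`, so a non-zero value proves
    -- integrability.
    refine not_imp_comm.1 integral_undef ?_
    rw [hφ]
    split_ifs
    · exact (gaussianConst_pos hp).ne'
    · exact one_ne_zero
  have h1 : ∀ y : Eucl N, ENNReal.ofReal (heatKernel 1 y) * ‖y i₀‖ₑ ^ p =
      ENNReal.ofReal (∏ i, φ i (y i)) := fun y => by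
    have : ∏ i, φ i (y i) = heatKernel 1 y * |y i₀| ^ p := by
      simp only [φ, Finset.prod_mul_distrib, heatKernel_one_eq_prod]
      congr 1
      rw [Finset.prod_ite_eq' Finset.univ i₀ fun i => |y i| ^ p]; simp
    rw [this, ENNReal.ofReal_mul (heatKernel_nonneg 1 zero_le_one y), ← Real.enorm_abs,
      Real.enorm_of_nonneg (abs_nonneg _), ENNReal.ofReal_rpow_of_nonneg (abs_nonneg _) hp0.le]
  simp_rw [h1]
  have h2 := (EuclideanSpace.volume_preserving_symm_measurableEquiv_toLp (Fin N)).lintegral_comp_emb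
    (MeasurableEquiv.measurableEmbedding _) (fun x => ENNReal.ofReal (∏ i, φ i (x i)))
  refine Eq.trans h2 ?_
  rw [← ofReal_integral_eq_lintegral_ofReal]
  · rw [integral_fintype_prod_volume_eq_prod]
    simp only [hφ, Finset.prod_ite_eq', Finset.mem_univ, if_true]
  · exact Integrable.fintype_prod hφi
  · refine Eventually.of_forall fun y => Finset.prod_nonneg fun i _ => ?_
    simp only [φ]; positivity

/-- By rotation invariance of the Gaussian: `g/‖g‖` is completed to an orthonormal basis, in which
the pairing is `‖g‖` times a coordinate. -/
lemma lintegral_heatKernel_mul_inner {p : ℝ} (hp : 1 ≤ p) (g : Eucl N) :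
    ∫⁻ z : Eucl N, ENNReal.ofReal (heatKernel 1 z) * ‖inner ℝ g z‖ₑ ^ p =
      ENNReal.ofReal (2 * Real.Gamma p / Real.Gamma (p / 2)) * ‖g‖ₑ ^ p := by
  have hp0 : 0 < p := by linarith
  rcases eq_or_ne g 0 with rfl | hg
  · simp [hp0]
  -- Only the existence of an index is used: it is the slot of the basis given to `g/‖g‖`.
  obtain ⟨i₀, -⟩ : ∃ i, g i ≠ 0 := by
    by_contra! h
    exact hg (by ext i; simpa using h i)
  have hn : ‖g‖ ≠ 0 := norm_ne_zero_iff.2 hg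
  obtain ⟨b, hb⟩ := Orthonormal.exists_orthonormalBasis_extension_of_card_eq (𝕜 := ℝ)
    (E := Eucl N) (ι := Fin N) (by simp) (v := fun _ => ‖g‖⁻¹ • g) (s := {i₀}) (by
      refine ⟨fun i => ?_, fun i j hij => absurd (Subsingleton.elim i j) hij⟩
      simp [norm_smul, hn])
  have hb0 : b i₀ = ‖g‖⁻¹ • g := hb i₀ rfl
  rw [← b.measurePreserving_repr_symm.lintegral_comp_emb
    (b.repr.symm.toHomeomorph.measurableEmbedding)]
  have h1 : ∀ y, ENNReal.ofReal (heatKernel 1 (b.repr.symm y)) *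
      ‖inner ℝ g (b.repr.symm y)‖ₑ ^ p =
      ‖g‖ₑ ^ p * (ENNReal.ofReal (heatKernel 1 y) * ‖y i₀‖ₑ ^ p) := fun y => by
    have h2 : inner ℝ g (b.repr.symm y) = ‖g‖ * y i₀ := by
      have : y i₀ = inner ℝ (b i₀) (b.repr.symm y) := by
        rw [← b.repr_apply_apply, LinearIsometryEquiv.apply_symm_apply]
      rw [this, hb0, inner_smul_left]
      simp [hn]
    have h3 : heatKernel 1 (b.repr.symm y) = heatKernel 1 y := by
      simp [heatKernel]
    rw [h2, h3, enorm_mul, ENNReal.mul_rpow_of_nonneg _ _ hp0.le, enorm_norm]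
    ring
  simp_rw [h1]
  rw [lintegral_const_mul' _ _ (ENNReal.rpow_ne_top_of_nonneg hp0.le enorm_ne_top),
    lintegral_heatKernel_mul_coord hp, mul_comm]

/-! ### Mollification -/

section Mollify

variable {E : Type*} [NormedAddCommGroup E] [NormedSpace ℝ E]

/-- Jensen's inequality, in the form `L^1 ≤ L^p` for the probability measure with density `η`. -/
lemma enorm_integral_smul_rpow_le {X : Type*} [MeasurableSpace X] {μ : Measure X} {p : ℝ}
    (hp : 1 ≤ p) {η : X → ℝ} (hη : Measurable η) (hη0 : ∀ x, 0 ≤ η x) (hηi : Integrable η μ)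
    (hη1 : ∫ x, η x ∂μ = 1) {f : X → E} (hf : StronglyMeasurable f) :
    ‖∫ x, η x • f x ∂μ‖ₑ ^ p ≤ ∫⁻ x, ENNReal.ofReal (η x) * ‖f x‖ₑ ^ p ∂μ := by
  have hp0 : 0 < p := by linarith
  set ν := μ.withDensity fun x => ENNReal.ofReal (η x)
  have hν : IsProbabilityMeasure ν := ⟨by
    rw [withDensity_apply _ MeasurableSet.univ, setLIntegral_univ,
      ← ofReal_integral_eq_lintegral_ofReal hηi (Eventually.of_forall hη0), hη1,
      ENNReal.ofReal_one]⟩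
  have h1 : ‖∫ x, η x • f x ∂μ‖ₑ ≤ eLpNorm f 1 ν := by
    rw [eLpNorm_one_eq_lintegral_enorm, lintegral_withDensity_eq_lintegral_mul _ (by fun_prop)
      hf.enorm]
    refine (enorm_integral_le_lintegral_enorm _).trans_eq (lintegral_congr fun x => ?_)
    rw [enorm_smul, Real.enorm_of_nonneg (hη0 x), Pi.mul_apply]
  have h2 : eLpNorm f 1 ν ≤ eLpNorm f (ENNReal.ofReal p) ν :=
    eLpNorm_le_eLpNorm_of_exponent_le (by simpa using hp) hf.aestronglyMeasurable
  calc ‖∫ x, η x • f x ∂μ‖ₑ ^ p ≤ eLpNorm f (ENNReal.ofReal p) ν ^ p := by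
        gcongr; exact h1.trans h2
    _ = ∫⁻ x, ‖f x‖ₑ ^ p ∂ν := by
        rw [eLpNorm_eq_lintegral_rpow_enorm_toReal (by simpa using hp0) (by simp),
          ENNReal.toReal_ofReal hp0.le, ← ENNReal.rpow_mul, one_div, inv_mul_cancel₀ hp0.ne',
          ENNReal.rpow_one]
    _ = _ := by
        rw [lintegral_withDensity_eq_lintegral_mul _ (by fun_prop)
          (hf.enorm.pow_const p)]
        rfl

/-- Mollification by a normed bump function. -/
def mollify (φ : ContDiffBump (0 : Eucl N)) (f : Eucl N → E) : Eucl N → E :=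
  convolution (φ.normed volume) f (ContinuousLinearMap.lsmul ℝ ℝ) volume

lemma mollify_apply (φ : ContDiffBump (0 : Eucl N)) (f : Eucl N → E) (x : Eucl N) :
    mollify φ f x = ∫ z, φ.normed volume z • f (x - z) := rfl

lemma mollify_apply' (φ : ContDiffBump (0 : Eucl N)) (f : Eucl N → E) (x : Eucl N) :
    mollify φ f x = ∫ z, φ.normed volume (x - z) • f z := by
  rw [mollify, convolution_lsmul_swap]

lemma contDiff_mollify (φ : ContDiffBump (0 : Eucl N)) {f : Eucl N → E}
    (hf : LocallyIntegrable f) : ContDiff ℝ ∞ (mollify φ f) :=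
  φ.hasCompactSupport_normed.contDiff_convolution_left _ φ.contDiff_normed hf

lemma integrable_mollify_integrand (φ : ContDiffBump (0 : Eucl N)) {f : Eucl N → E}
    (hf : LocallyIntegrable f) (x : Eucl N) :
    Integrable fun z => φ.normed volume z • f (x - z) :=
  φ.hasCompactSupport_normed.convolutionExists_left (ContinuousLinearMap.lsmul ℝ ℝ)
    φ.continuous_normed hf x

lemma integrable_mollify_integrand' (φ : ContDiffBump (0 : Eucl N)) {f : Eucl N → E}
    (hf : LocallyIntegrable f) (x : Eucl N) :
    Integrable fun z => φ.normed volume (x - z) • f z := by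
  have := (integrable_mollify_integrand φ hf x).comp_sub_left x
  simpa using this

lemma enorm_mollify_rpow_le {p : ℝ} (hp : 1 ≤ p) (φ : ContDiffBump (0 : Eucl N))
    {f : Eucl N → E} (hf : StronglyMeasurable f) (x : Eucl N) :
    ‖mollify φ f x‖ₑ ^ p ≤ ∫⁻ z, ENNReal.ofReal (φ.normed volume z) * ‖f (x - z)‖ₑ ^ p := by
  rw [mollify_apply]
  exact enorm_integral_smul_rpow_le hp φ.continuous_normed.measurable φ.nonneg_normed
    φ.integrable_normed φ.integral_normed
    (hf.comp_measurable (measurable_const.sub measurable_id))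

lemma lintegral_normed_bump (φ : ContDiffBump (0 : Eucl N)) :
    ∫⁻ z, ENNReal.ofReal (φ.normed volume z) = 1 := by
  rw [← ofReal_integral_eq_lintegral_ofReal φ.integrable_normed
    (Eventually.of_forall φ.nonneg_normed), φ.integral_normed, ENNReal.ofReal_one]

lemma lintegral_enorm_mollify_rpow_le {p : ℝ} (hp : 1 ≤ p) (φ : ContDiffBump (0 : Eucl N))
    {f : Eucl N → E} (hf : StronglyMeasurable f) :
    ∫⁻ x, ‖mollify φ f x‖ₑ ^ p ≤ ∫⁻ x, ‖f x‖ₑ ^ p := by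
  have hm : Measurable fun q : Eucl N × Eucl N =>
      ENNReal.ofReal (φ.normed volume q.2) * ‖f (q.1 - q.2)‖ₑ ^ p := by
    have h1 := φ.continuous_normed (μ := (volume : Measure (Eucl N)))
    have h2 := (hf.enorm).comp (measurable_fst.sub measurable_snd :
      Measurable fun q : Eucl N × Eucl N => q.1 - q.2)
    exact ((h1.measurable.comp measurable_snd).ennreal_ofReal).mul (h2.pow_const p)
  calc ∫⁻ x, ‖mollify φ f x‖ₑ ^ p
      ≤ ∫⁻ x, ∫⁻ z, ENNReal.ofReal (φ.normed volume z) * ‖f (x - z)‖ₑ ^ p :=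
        lintegral_mono fun x => enorm_mollify_rpow_le hp φ hf x
    _ = ∫⁻ z, ENNReal.ofReal (φ.normed volume z) * ∫⁻ x, ‖f x‖ₑ ^ p := by
        rw [lintegral_lintegral_swap hm.aemeasurable]
        congr with z
        rw [lintegral_const_mul' _ _ ENNReal.ofReal_ne_top,
          lintegral_sub_right_eq_self (fun x => ‖f x‖ₑ ^ p) z]
    _ = ∫⁻ x, ‖f x‖ₑ ^ p := by
        have h1 := φ.continuous_normed (μ := (volume : Measure (Eucl N)))
        rw [lintegral_mul_const _ (by fun_prop), lintegral_normed_bump, one_mul]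

end Mollify

/-- Mollification commutes with translations and is an `L^p` contraction, here applied to the
increment of `u`. -/
lemma translationEnergy_mollify_le {p : ℝ} (hp : 1 ≤ p) (φ : ContDiffBump (0 : Eucl N))
    {u : Eucl N → ℝ} (hum : Measurable u) (hu : LocallyIntegrable u) (h : Eucl N) :
    translationEnergy p (mollify φ u) h ≤ translationEnergy p u h := by
  have h1 : ∀ x, mollify φ u (x + h) - mollify φ u x = mollify φ (fun x => u (x + h) - u x) x := by
    intro x
    simp only [mollify_apply]
    rw [← integral_sub (integrable_mollify_integrand φ hu _) (integrable_mollify_integrand φ hu _)]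
    congr with z
    rw [← smul_sub, sub_add_eq_add_sub]
  unfold translationEnergy
  simp_rw [h1]
  exact lintegral_enorm_mollify_rpow_le hp φ (Measurable.stronglyMeasurable (by fun_prop))

lemma heatEnergy_mollify_le {p : ℝ} (hp : 1 ≤ p) (φ : ContDiffBump (0 : Eucl N))
    {u : Eucl N → ℝ} (hum : Measurable u) (hu : LocallyIntegrable u) (t : ℝ) :
    heatEnergy p t (mollify φ u) ≤ heatEnergy p t u := by
  rw [heatEnergy_eq p t hum, heatEnergy_eq p t (contDiff_mollify φ hu).continuous.measurable]
  gcongr with z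
  exact translationEnergy_mollify_le hp φ hum hu z

/-- The bump function with radii `ε / 2` and `ε`. -/
def stdBump (N : ℕ) (ε : ℝ) (hε : 0 < ε) : ContDiffBump (0 : Eucl N) :=
  ⟨ε / 2, ε, by positivity, by linarith⟩

/-- A constant bounding the mollifiers by multiples of the heat kernel. -/
def bumpConst (N : ℕ) : ℝ :=
  2 ^ N / volume.real (Metric.closedBall (0 : Eucl N) 1) *
    ((4 * Real.pi) ^ ((N : ℝ) / 2) * Real.exp 1)

/-- The mollifier lives on the ball of radius `ε` and has height at most `2^N / |B_ε|`. There `ε²/4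
≤ s` keeps the exponent of the heat kernel above `-1`, and `s ≤ ε²` keeps its prefactor above
`(4πε²)^{-N/2}`. A whole window of times is allowed because `s` will be of the form `m² t_k`. -/
lemma stdBump_normed_le {ε : ℝ} (hε : 0 < ε) {s : ℝ} (hs1 : ε ^ 2 / 4 ≤ s) (hs2 : s ≤ ε ^ 2)
    (z : Eucl N) :
    (stdBump N ε hε).normed volume z ≤ bumpConst N * heatKernel s z := by
  have hs : 0 < s := lt_of_lt_of_le (by positivity) hs1
  have hV : 0 < volume.real (Metric.closedBall (0 : Eucl N) 1) :=
    ENNReal.toReal_pos (Metric.measure_closedBall_pos _ _ one_pos).ne'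
      measure_closedBall_lt_top.ne
  have hC : 0 ≤ bumpConst N := by unfold bumpConst; positivity
  by_cases hz : z ∈ Metric.ball (0 : Eucl N) ε
  · have h1 := (stdBump N ε hε).normed_le_div_measure_closedBall_rOut volume 2
      (by simp [stdBump]; linarith) z
    rw [finrank_euclideanSpace_fin, show (stdBump N ε hε).rOut = ε from rfl,
      Measure.addHaar_real_closedBall' _ _ hε.le,
      finrank_euclideanSpace_fin] at h1
    have h2 : Real.exp (-1) / ((4 * Real.pi) ^ ((N : ℝ) / 2) * ε ^ N) ≤ heatKernel s z := by
      unfold heatKernel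
      have hz' : ‖z‖ ≤ ε := (mem_ball_zero_iff.1 hz).le
      have h3 : (4 * Real.pi) ^ ((N : ℝ) / 2) * ε ^ N = (4 * Real.pi * ε ^ 2) ^ ((N : ℝ) / 2) := by
        rw [Real.mul_rpow (x := 4 * Real.pi) (by positivity) (by positivity),
          ← Real.rpow_natCast ε 2,
          ← Real.rpow_mul hε.le, ← Real.rpow_natCast ε N]
        congr 2; push_cast; ring
      rw [h3]
      gcongr
      rw [le_div_iff₀ (by positivity)]
      nlinarith [norm_nonneg z]
    refine h1.trans (le_trans ?_ (mul_le_mul_of_nonneg_left h2 hC))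
    unfold bumpConst
    rw [Real.exp_neg]
    have := Real.exp_pos 1
    have : 0 < (4 * Real.pi) ^ ((N : ℝ) / 2) := by positivity
    apply le_of_eq
    field_simp
  · have : (stdBump N ε hε).normed volume z = 0 := by
      rw [← Function.notMem_support, ContDiffBump.support_normed_eq]
      exact hz
    rw [this]
    exact mul_nonneg hC (heatKernel_nonneg s hs.le z)

/-- Jensen bounds the error by the mollifier's average of translation energies, and the mollifier is
dominated by the heat kernel. This rate gives both the `L^p` convergence of mollifications and the
compactness. -/
lemma lintegral_enorm_mollify_sub_rpow_le {p : ℝ} (hp : 1 ≤ p) {u : Eucl N → ℝ}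
    (hum : Measurable u) (hu : LocallyIntegrable u) {ε : ℝ} (hε : 0 < ε) {s : ℝ}
    (hs1 : ε ^ 2 / 4 ≤ s) (hs2 : s ≤ ε ^ 2) :
    ∫⁻ x, ‖mollify (stdBump N ε hε) u x - u x‖ₑ ^ p ≤
      ENNReal.ofReal (bumpConst N * s ^ (p / 2)) * heatEnergy p s u := by
  have hs : 0 < s := lt_of_lt_of_le (by positivity) hs1
  have hp0 : 0 < p := by linarith
  set φ := stdBump N ε hε
  have hφ := φ.continuous_normed (μ := (volume : Measure (Eucl N)))
  have h1 : ∀ x, mollify φ u x - u x = ∫ z, φ.normed volume z • (u (x - z) - u x) := by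
    intro x
    simp only [mollify_apply, smul_sub]
    rw [integral_sub (integrable_mollify_integrand φ hu _) (φ.integrable_normed.smul_const _),
      integral_smul_const, φ.integral_normed, one_smul]
  have h2 : ∀ x, ‖mollify φ u x - u x‖ₑ ^ p ≤
      ∫⁻ z, ENNReal.ofReal (φ.normed volume z) * ‖u (x - z) - u x‖ₑ ^ p := fun x => by
    rw [h1]
    exact enorm_integral_smul_rpow_le hp φ.continuous_normed.measurable φ.nonneg_normed
      φ.integrable_normed φ.integral_normed (Measurable.stronglyMeasurable (by fun_prop))
  have hC : 0 ≤ bumpConst N := by unfold bumpConst; positivity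
  have hT := measurable_translationEnergy p hum
  calc ∫⁻ x, ‖mollify φ u x - u x‖ₑ ^ p
      ≤ ∫⁻ x, ∫⁻ z, ENNReal.ofReal (φ.normed volume z) * ‖u (x - z) - u x‖ₑ ^ p :=
        lintegral_mono h2
    _ = ∫⁻ z, ENNReal.ofReal (φ.normed volume z) * translationEnergy p u (-z) := by
        rw [lintegral_lintegral_swap (by
          refine Measurable.aemeasurable ?_
          simp only [Function.uncurry_def]; fun_prop)]
        congr with z
        rw [lintegral_const_mul' _ _ ENNReal.ofReal_ne_top]
        rfl
    _ ≤ ∫⁻ z, ENNReal.ofReal (bumpConst N) *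
          (ENNReal.ofReal (heatKernel s (-z)) * translationEnergy p u (-z)) := by
        refine lintegral_mono fun z => ?_
        rw [← mul_assoc, ← ENNReal.ofReal_mul hC, heatKernel_neg]
        gcongr
        exact stdBump_normed_le hε hs1 hs2 z
    _ = _ := by
        rw [lintegral_const_mul' _ _ ENNReal.ofReal_ne_top, heatEnergy_eq p s hum, ← mul_assoc,
          ← ENNReal.ofReal_mul (by positivity), mul_assoc, ← Real.rpow_add hs,
          lintegral_neg_eq_self (fun z =>
            ENNReal.ofReal (heatKernel s z) * translationEnergy p u z)]
        simp

lemma ae_tendsto_mollify {E : Type*} [NormedAddCommGroup E] [NormedSpace ℝ E] [CompleteSpace E]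
    {u : Eucl N → E} (hu : LocallyIntegrable u) {ε : ℕ → ℝ} (hε : ∀ n, 0 < ε n)
    (hε0 : Tendsto ε atTop (𝓝 0)) :
    ∀ᵐ x, Tendsto (fun n => mollify (stdBump N (ε n) (hε n)) u x) atTop (𝓝 (u x)) :=
  ContDiffBump.ae_convolution_tendsto_right_of_locallyIntegrable (K := 2) hε0
    (Eventually.of_forall fun n => by simp [stdBump]; linarith) hu

/-! ### Heat energies of smooth functions -/

lemma inner_gradient_eq (w : Eucl N → ℝ) (x h : Eucl N) :
    inner ℝ (gradient w x) h = fderiv ℝ w x h := by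
  rw [gradient, InnerProductSpace.toDual_symm_apply]

lemma gradient_apply (w : Eucl N → ℝ) (x : Eucl N) (i : Fin N) :
    gradient w x i = fderiv ℝ w x (EuclideanSpace.single i 1) := by
  rw [← inner_gradient_eq, EuclideanSpace.inner_single_right]; simp

lemma contDiff_gradient {w : Eucl N → ℝ} (hw : ContDiff ℝ ∞ w) :
    ContDiff ℝ ∞ (gradient w) :=
  (InnerProductSpace.toDual ℝ (Eucl N)).symm.toContinuousLinearEquiv.contDiff.comp
    (hw.fderiv_right (by simp))

lemma continuous_gradient {w : Eucl N → ℝ} (hw : ContDiff ℝ 1 w) : Continuous (gradient w) :=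
  (InnerProductSpace.toDual ℝ (Eucl N)).symm.continuous.comp (hw.continuous_fderiv one_ne_zero)

/-- The factor `1` plays the role of the density `η` in `enorm_integral_smul_rpow_le`. -/
lemma sub_eq_integral_fderiv {w : Eucl N → ℝ} (hw : ContDiff ℝ 1 w) (x h : Eucl N) :
    w (x + h) - w x = ∫ s in Set.Ioc (0 : ℝ) 1, (1 : ℝ) • inner ℝ (gradient w (x + s • h)) h := by
  have hc : Continuous fun s : ℝ => inner ℝ (gradient w (x + s • h)) h :=
    ((continuous_gradient hw).comp (by fun_prop)).inner continuous_const
  have h1 := intervalIntegral.integral_eq_sub_of_hasDerivAt (a := 0) (b := 1)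
    (f := fun s : ℝ => w (x + s • h)) (f' := fun s => inner ℝ (gradient w (x + s • h)) h)
    (fun s _ => by
      rw [inner_gradient_eq]
      have h2 : HasDerivAt (fun s : ℝ => x + s • h) h s := by
        simpa using ((hasDerivAt_id s).smul_const h).const_add x
      exact ((hw.differentiable one_ne_zero) _).hasFDerivAt.comp_hasDerivAt s h2)
    (hc.intervalIntegrable _ _)
  simp only [one_smul, zero_smul, add_zero] at h1
  rw [← h1, intervalIntegral.integral_of_le zero_le_one]
  simp

/-- Jensen on the segment from `x` to `x + h`, then Tonelli and translation invariance in `x`. -/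
lemma translationEnergy_le_of_contDiff {p : ℝ} (hp : 1 ≤ p) {w : Eucl N → ℝ}
    (hw : ContDiff ℝ 1 w) (h : Eucl N) :
    translationEnergy p w h ≤ ∫⁻ x, ‖inner ℝ (gradient w x) h‖ₑ ^ p := by
  have hg := continuous_gradient hw
  have h1 : ∀ x, ‖w (x + h) - w x‖ₑ ^ p ≤
      ∫⁻ s in Set.Ioc (0 : ℝ) 1, ‖inner ℝ (gradient w (x + s • h)) h‖ₑ ^ p := fun x => by
    rw [sub_eq_integral_fderiv hw x h]
    refine (enorm_integral_smul_rpow_le hp (η := fun _ => 1) (by fun_prop) (by simp) (by simp)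
      (by simp) (Continuous.stronglyMeasurable (by fun_prop))).trans_eq ?_
    simp
  calc translationEnergy p w h
      ≤ ∫⁻ x, ∫⁻ s in Set.Ioc (0 : ℝ) 1, ‖inner ℝ (gradient w (x + s • h)) h‖ₑ ^ p :=
        lintegral_mono h1
    _ = ∫⁻ s in Set.Ioc (0 : ℝ) 1, ∫⁻ x, ‖inner ℝ (gradient w x) h‖ₑ ^ p := by
        rw [lintegral_lintegral_swap (by
          refine Measurable.aemeasurable ?_
          simp only [Function.uncurry_def]
          refine Measurable.pow_const (Measurable.enorm (Continuous.measurable ?_)) p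
          fun_prop)]
        congr with s
        exact lintegral_add_right_eq_self (fun x => ‖inner ℝ (gradient w x) h‖ₑ ^ p) (s • h)
    _ = _ := by simp

lemma lintegral_lintegral_inner {p : ℝ} (hp : 1 ≤ p) {G : Eucl N → Eucl N} (hG : Measurable G) :
    ∫⁻ z, ENNReal.ofReal (heatKernel 1 z) * ∫⁻ x, ‖inner ℝ (G x) z‖ₑ ^ p =
      ENNReal.ofReal (2 * Real.Gamma p / Real.Gamma (p / 2)) * ∫⁻ x, ‖G x‖ₑ ^ p := by
  rw [← lintegral_const_mul' _ _ ENNReal.ofReal_ne_top]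
  simp_rw [← lintegral_heatKernel_mul_inner hp, ← lintegral_const_mul' _ _ ENNReal.ofReal_ne_top]
  rw [lintegral_lintegral_swap]
  refine Measurable.aemeasurable ?_
  simp only [Function.uncurry_def]
  fun_prop

/-- With `h = √t z`, the `p`-homogeneity of the directional derivative cancels `t^{-p/2}`, and
averaging over `z` produces the Gaussian moment. -/
lemma heatEnergy_le_of_contDiff {p : ℝ} (hp : 1 ≤ p) {w : Eucl N → ℝ}
    (hw : ContDiff ℝ 1 w) {t : ℝ} (ht : 0 < t) :
    heatEnergy p t w ≤
      ENNReal.ofReal (2 * Real.Gamma p / Real.Gamma (p / 2)) * ∫⁻ x, ‖gradient w x‖ₑ ^ p := by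
  have hp0 : 0 < p := by linarith
  have hst : 0 < √t := Real.sqrt_pos.2 ht
  rw [heatEnergy_eq_rescaled p ht hw.continuous.measurable,
    ← lintegral_lintegral_inner hp (continuous_gradient hw).measurable,
    ← lintegral_const_mul' _ _ ENNReal.ofReal_ne_top]
  refine lintegral_mono fun z => ?_
  rw [mul_left_comm]
  gcongr
  refine (mul_le_mul' le_rfl (translationEnergy_le_of_contDiff hp hw _)).trans_eq ?_
  rw [← lintegral_const_mul' _ _ ENNReal.ofReal_ne_top]
  congr with x
  rw [inner_smul_right, enorm_mul, ENNReal.mul_rpow_of_nonneg _ _ hp0.le, ← mul_assoc,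
    Real.enorm_of_nonneg hst.le, ENNReal.ofReal_rpow_of_pos hst, ← ENNReal.ofReal_mul
    (by positivity), Real.sqrt_eq_rpow, ← Real.rpow_mul ht.le, ← Real.rpow_add ht]
  rw [show -(p / 2) + 1 / 2 * p = 0 by ring]; simp

/-- At times `r_n² → 0` the rescaled increments are difference quotients converging to `⟨∇w(x), z⟩`;
Fatou is applied in `x` and then in `z`, so no integrability of the gradient is presupposed. -/
lemma gradEnergy_le_of_contDiff {p : ℝ} (hp : 1 ≤ p) {w : Eucl N → ℝ} (hw : ContDiff ℝ 1 w)
    {a : ℝ≥0∞} (ha : ∀ s, 0 < s → heatEnergy p s w ≤ a) :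
    ENNReal.ofReal (2 * Real.Gamma p / Real.Gamma (p / 2)) * ∫⁻ x, ‖gradient w x‖ₑ ^ p ≤ a := by
  have hp0 : 0 < p := by linarith
  have hwm := hw.continuous.measurable
  rw [← lintegral_lintegral_inner hp (continuous_gradient hw).measurable]
  let r : ℕ → ℝ := fun n => 1 / ((n : ℝ) + 1)
  have hr : ∀ n, 0 < r n := fun n => by positivity
  have hr0 : Tendsto r atTop (𝓝[≠] 0) := tendsto_nhdsWithin_iff.2
    ⟨tendsto_one_div_add_atTop_nhds_zero_nat, Eventually.of_forall fun n => (hr n).ne'⟩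
  let F : ℕ → Eucl N → Eucl N → ℝ≥0∞ := fun n z x => ‖(r n)⁻¹ * (w (x + r n • z) - w x)‖ₑ ^ p
  have hFm : ∀ n, Measurable (Function.uncurry (F n)) := fun n => by
    simp only [F, Function.uncurry_def]; fun_prop
  have hE : ∀ n, heatEnergy p (r n ^ 2) w =
      ∫⁻ z, ENNReal.ofReal (heatKernel 1 z) * ∫⁻ x, F n z x := fun n => by
    rw [heatEnergy_eq_rescaled p (pow_pos (hr n) 2) hwm, Real.sqrt_sq (hr n).le,
      ← lintegral_const_mul' _ _ ENNReal.ofReal_ne_top]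
    congr with z
    rw [mul_left_comm]
    congr 1
    rw [translationEnergy, ← lintegral_const_mul' _ _ ENNReal.ofReal_ne_top]
    congr with x
    simp only [F]
    rw [enorm_mul, ENNReal.mul_rpow_of_nonneg _ _ hp0.le,
      Real.enorm_of_nonneg (inv_nonneg.2 (hr n).le), ENNReal.ofReal_rpow_of_pos (inv_pos.2 (hr n)),
      Real.inv_rpow (hr n).le, ← Real.rpow_neg (hr n).le, ← Real.rpow_natCast,
      ← Real.rpow_mul (hr n).le]
    congr 3
    push_cast; ring
  have hlim : ∀ z x, Tendsto (fun n => F n z x) atTop (𝓝 (‖inner ℝ (gradient w x) z‖ₑ ^ p)) := by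
    intro z x
    have h2 : HasDerivAt (fun s : ℝ => w (x + s • z)) (inner ℝ (gradient w x) z) 0 := by
      rw [inner_gradient_eq]
      have h2 : HasDerivAt (fun s : ℝ => x + s • z) z 0 := by
        simpa using ((hasDerivAt_id (0 : ℝ)).smul_const z).const_add x
      refine HasFDerivAt.comp_hasDerivAt (0 : ℝ) ?_ h2
      simpa using ((hw.differentiable one_ne_zero) x).hasFDerivAt
    have h3 := (hasDerivAt_iff_tendsto_slope_zero.1 h2).comp hr0
    simp only [zero_add, zero_smul, add_zero, smul_eq_mul] at h3
    exact (h3.enorm).ennrpow_const p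
  calc ∫⁻ z, ENNReal.ofReal (heatKernel 1 z) * ∫⁻ x, ‖inner ℝ (gradient w x) z‖ₑ ^ p
      ≤ ∫⁻ z, liminf (fun n => ENNReal.ofReal (heatKernel 1 z) * ∫⁻ x, F n z x) atTop := by
        refine lintegral_mono fun z => ?_
        have h4 : ∫⁻ x, ‖inner ℝ (gradient w x) z‖ₑ ^ p ≤
            liminf (fun n => ∫⁻ x, F n z x) atTop := by
          refine le_trans (le_of_eq ?_)
            (lintegral_liminf_le fun n => (hFm n).of_uncurry_left)
          congr with x
          exact (hlim z x).liminf_eq.symm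
        rw [ENNReal.liminf_const_mul_of_ne_top (by simp)]
        gcongr
    _ ≤ liminf (fun n => ∫⁻ z, ENNReal.ofReal (heatKernel 1 z) * ∫⁻ x, F n z x) atTop :=
        lintegral_liminf_le fun n =>
          (measurable_heatKernel 1).ennreal_ofReal.mul (hFm n).lintegral_prod_right'
    _ ≤ a := by
        simp_rw [← hE]
        exact liminf_le_of_frequently_le' (Frequently.of_forall fun n => ha _ (pow_pos (hr n) 2))

/-! ### Integration by parts and mollification of gradients -/

lemma fderiv_coord_apply {ψ : Eucl N → Eucl N} {x : Eucl N} (hψ : DifferentiableAt ℝ ψ x)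
    (i : Fin N) (v : Eucl N) : fderiv ℝ (fun y => ψ y i) x v = fderiv ℝ ψ x v i := by
  have h := (EuclideanSpace.proj i : Eucl N →L[ℝ] ℝ).hasFDerivAt.comp x
    hψ.hasFDerivAt
  have h2 : HasFDerivAt (fun y => ψ y i) _ x := h
  rw [h2.fderiv]; rfl

lemma contDiff_coord {n : WithTop ℕ∞} {ψ : Eucl N → Eucl N} (hψ : ContDiff ℝ n ψ) (i : Fin N) :
    ContDiff ℝ n fun y => ψ y i :=
  (EuclideanSpace.proj i : Eucl N →L[ℝ] ℝ).contDiff.comp hψ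

lemma hasCompactSupport_coord {ψ : Eucl N → Eucl N} (hψ : HasCompactSupport ψ) (i : Fin N) :
    HasCompactSupport fun y => ψ y i :=
  hψ.comp_left (g := fun v : Eucl N => v i) rfl

lemma integral_mul_fderiv_eq_neg_gradient {w : Eucl N → ℝ} (hw : ContDiff ℝ 1 w)
    {φ : Eucl N → ℝ} (hφ : ContDiff ℝ 1 φ) (hφc : HasCompactSupport φ) (i : Fin N) :
    ∫ x, w x * fderiv ℝ φ x (EuclideanSpace.single i 1) = -∫ x, gradient w x i * φ x := by
  have hdw := (hw.continuous_fderiv one_ne_zero).clm_apply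
    (continuous_const (y := EuclideanSpace.single i (1 : ℝ)))
  have hdφ := (hφ.continuous_fderiv one_ne_zero).clm_apply
    (continuous_const (y := EuclideanSpace.single i (1 : ℝ)))
  simp_rw [gradient_apply]
  refine integral_mul_fderiv_eq_neg_fderiv_mul_of_integrable ?_ ?_ ?_
    (fun x _ => (hw.differentiable one_ne_zero) x) (fun x _ => (hφ.differentiable one_ne_zero) x)
  · exact (hdw.mul hφ.continuous).integrable_of_hasCompactSupport hφc.mul_left
  · exact (hw.continuous.mul hdφ).integrable_of_hasCompactSupport
      (hφc.fderiv_apply ℝ _).mul_left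
  · exact (hw.continuous.mul hφ.continuous).integrable_of_hasCompactSupport hφc.mul_left

lemma continuous_divergence {ψ : Eucl N → Eucl N} (hψ : ContDiff ℝ 1 ψ) :
    Continuous (divergence ψ) := by
  unfold divergence
  refine continuous_finsetSum _ fun i _ => ?_
  have := (hψ.continuous_fderiv one_ne_zero).clm_apply
    (continuous_const (y := EuclideanSpace.single i (1 : ℝ)))
  fun_prop

lemma hasCompactSupport_divergence {ψ : Eucl N → Eucl N} (hψ : HasCompactSupport ψ) :
    HasCompactSupport (divergence ψ) := by
  refine (hψ.fderiv (𝕜 := ℝ)).comp_left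
    (g := fun L : Eucl N →L[ℝ] Eucl N => ∑ i : Fin N, L (EuclideanSpace.single i 1) i) ?_
  simp

lemma integral_mul_divergence {w : Eucl N → ℝ} (hw : ContDiff ℝ 1 w)
    {ψ : Eucl N → Eucl N} (hψ : ContDiff ℝ 1 ψ) (hψc : HasCompactSupport ψ) :
    ∫ x, w x * divergence ψ x = -∫ x, inner ℝ (gradient w x) (ψ x) := by
  have hg := continuous_gradient hw
  have hd : ∀ i, Continuous fun x => fderiv ℝ (fun y => ψ y i) x (EuclideanSpace.single i 1) :=
    fun i => ((contDiff_coord hψ i).continuous_fderiv one_ne_zero).clm_apply continuous_const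
  have h1 : ∀ x, w x * divergence ψ x =
      ∑ i, w x * fderiv ℝ (fun y => ψ y i) x (EuclideanSpace.single i 1) := fun x => by
    rw [divergence, Finset.mul_sum]
    refine Finset.sum_congr rfl fun i _ => ?_
    rw [fderiv_coord_apply ((hψ.differentiable one_ne_zero) x)]
  have h2 : ∀ x, inner ℝ (gradient w x) (ψ x) = ∑ i, gradient w x i * ψ x i := fun x => by
    simp only [PiLp.inner_apply, RCLike.inner_apply, conj_trivial, mul_comm]
  simp_rw [h1, h2]
  rw [integral_finsetSum, integral_finsetSum, ← Finset.sum_neg_distrib]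
  · exact Finset.sum_congr rfl fun i _ => integral_mul_fderiv_eq_neg_gradient hw
      (contDiff_coord hψ i) (hasCompactSupport_coord hψc i) i
  · intro i _
    refine Continuous.integrable_of_hasCompactSupport ?_ (hasCompactSupport_coord hψc i).mul_left
    have := hψ.continuous
    fun_prop
  · intro i _
    exact (hw.continuous.mul (hd i)).integrable_of_hasCompactSupport
      ((hasCompactSupport_coord hψc i).fderiv_apply ℝ _).mul_left

lemma mollify_congr_ae {E : Type*} [NormedAddCommGroup E] [NormedSpace ℝ E]
    (φ : ContDiffBump (0 : Eucl N)) {f g : Eucl N → E} (h : f =ᵐ[volume] g) :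
    mollify φ f = mollify φ g := by
  ext x
  rw [mollify_apply', mollify_apply']
  refine integral_congr_ae ?_
  filter_upwards [h] with z hz
  rw [hz]

lemma mollify_coord (φ : ContDiffBump (0 : Eucl N)) {G : Eucl N → Eucl N}
    (hG : LocallyIntegrable G) (x : Eucl N) (i : Fin N) :
    mollify φ G x i = mollify φ (fun z => G z i) x := by
  rw [mollify_apply, mollify_apply]
  exact ((EuclideanSpace.proj i : Eucl N →L[ℝ] ℝ).integral_comp_comm
    (integrable_mollify_integrand φ hG x)).symm

lemma fderiv_mollify_apply (φ : ContDiffBump (0 : Eucl N)) {u : Eucl N → ℝ}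
    (hu : LocallyIntegrable u) (x v : Eucl N) :
    fderiv ℝ (mollify φ u) x v = ∫ z, u z * fderiv ℝ (φ.normed volume) (x - z) v := by
  have h1 : mollify φ u = convolution u (φ.normed volume) (ContinuousLinearMap.mul ℝ ℝ)
      volume := by
    ext y
    rw [mollify_apply', convolution]
    congr with z
    simp [mul_comm]
  have hφ : ContDiff ℝ 1 (φ.normed (volume : Measure (Eucl N))) := φ.contDiff_normed (n := 1)
  have h2 := φ.hasCompactSupport_normed.hasFDerivAt_convolution_right
    (ContinuousLinearMap.mul ℝ ℝ) hu hφ x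
  rw [h1, h2.fderiv, convolution_precompR_apply _ hu (φ.hasCompactSupport_normed.fderiv (𝕜 := ℝ))
    (hφ.continuous_fderiv one_ne_zero)]
  rfl

/-- The weak gradient is tested against `φ(x - ·)`; the sign from the reflection cancels that of the
integration by parts. -/
lemma gradient_mollify_of_isWeakGradient (φ : ContDiffBump (0 : Eucl N)) {u : Eucl N → ℝ}
    {G : Eucl N → Eucl N} (h : IsWeakGradient u G) :
    gradient (mollify φ u) = mollify φ G := by
  obtain ⟨hu, hG, hw⟩ := h
  ext x i
  have hd := (φ.contDiff_normed (n := 1) (μ := (volume : Measure (Eucl N)))).differentiable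
    one_ne_zero
  have hψ : ContDiff ℝ ∞ fun z => φ.normed volume (x - z) :=
    φ.contDiff_normed.comp (contDiff_const.sub contDiff_id)
  have hψc : HasCompactSupport fun z => φ.normed volume (x - z) :=
    φ.hasCompactSupport_normed.comp_homeomorph (Homeomorph.subLeft x)
  have h1 := hw _ hψ hψc i
  have h2 : ∀ z, fderiv ℝ (fun z => φ.normed volume (x - z)) z (EuclideanSpace.single i 1) =
      -fderiv ℝ (φ.normed volume) (x - z) (EuclideanSpace.single i 1) := fun z => by
    have h3 : HasFDerivAt (fun z => φ.normed volume (x - z)) _ z :=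
      (hd (x - z)).hasFDerivAt.comp z ((hasFDerivAt_id z).const_sub x)
    rw [h3.fderiv]; simp
  simp_rw [h2, mul_neg, integral_neg, neg_inj] at h1
  rw [gradient_apply, fderiv_mollify_apply φ hu, h1, mollify_coord φ hG, mollify_apply']
  simp [mul_comm]

lemma lintegral_gradient_mollify_le_of_isWeakGradient {p : ℝ} (hp : 1 ≤ p)
    (φ : ContDiffBump (0 : Eucl N)) {u : Eucl N → ℝ} {G : Eucl N → Eucl N}
    (h : IsWeakGradient u G) :
    ∫⁻ x, ‖gradient (mollify φ u) x‖ₑ ^ p ≤ ∫⁻ x, ‖G x‖ₑ ^ p := by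
  obtain ⟨G', hG', hGG'⟩ := h.2.1.aestronglyMeasurable
  rw [gradient_mollify_of_isWeakGradient φ h, mollify_congr_ae φ hGG']
  refine (lintegral_enorm_mollify_rpow_le hp φ hG').trans_eq (lintegral_congr_ae ?_)
  filter_upwards [hGG'] with x hx
  rw [hx]

lemma fderiv_mollify_eq (φ : ContDiffBump (0 : Eucl N)) {ψ : Eucl N → Eucl N}
    (hψ : ContDiff ℝ 1 ψ) (hψc : HasCompactSupport ψ) (x v : Eucl N) :
    fderiv ℝ (mollify φ ψ) x v = mollify φ (fun y => fderiv ℝ ψ y v) x := by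
  have hl : LocallyIntegrable (φ.normed volume) (volume : Measure (Eucl N)) :=
    φ.integrable_normed.locallyIntegrable
  have h2 := hψc.hasFDerivAt_convolution_right (ContinuousLinearMap.lsmul ℝ ℝ) hl hψ x
  rw [mollify, h2.fderiv, convolution_precompR_apply _ hl (hψc.fderiv (𝕜 := ℝ))
    (hψ.continuous_fderiv one_ne_zero)]
  rfl

lemma divergence_mollify (φ : ContDiffBump (0 : Eucl N)) {ψ : Eucl N → Eucl N}
    (hψ : ContDiff ℝ 1 ψ) (hψc : HasCompactSupport ψ) (x : Eucl N) :
    divergence (mollify φ ψ) x = mollify φ (divergence ψ) x := by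
  have hd : ∀ i, Continuous fun y => fderiv ℝ ψ y (EuclideanSpace.single i 1) := fun i =>
    (hψ.continuous_fderiv one_ne_zero).clm_apply continuous_const
  have h1 : ∀ i, Continuous fun y => fderiv ℝ ψ y (EuclideanSpace.single i 1) i := fun i => by
    have := hd i
    fun_prop
  unfold divergence
  simp_rw [fderiv_mollify_eq φ hψ hψc, mollify_coord φ (hd _).locallyIntegrable]
  simp only [mollify_apply, Finset.smul_sum]
  rw [integral_finsetSum]
  exact fun i _ => integrable_mollify_integrand φ (h1 i).locallyIntegrable x

lemma norm_mollify_le_one (φ : ContDiffBump (0 : Eucl N)) {ψ : Eucl N → Eucl N}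
    (hψ : ∀ x, ‖ψ x‖ ≤ 1) (x : Eucl N) : ‖mollify φ ψ x‖ ≤ 1 := by
  rw [mollify_apply]
  refine (norm_integral_le_of_norm_le φ.integrable_normed (Eventually.of_forall fun z => ?_)).trans
    φ.integral_normed.le
  rw [norm_smul, Real.norm_of_nonneg (φ.nonneg_normed z)]
  exact mul_le_of_le_one_right (φ.nonneg_normed z) (hψ _)

/-- Fubini and evenness of the mollifier, whose boundedness gives the joint integrability. -/
lemma integral_mollify_mul (φ : ContDiffBump (0 : Eucl N)) {u D : Eucl N → ℝ}
    (hu : Integrable u) (hD : Integrable D) :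
    ∫ x, mollify φ u x * D x = ∫ x, u x * mollify φ D x := by
  obtain ⟨C, hC⟩ := φ.hasCompactSupport_normed.exists_bound_of_continuous
    (φ.continuous_normed (μ := (volume : Measure (Eucl N))))
  have h1 : Integrable (Function.uncurry fun x z : Eucl N => φ.normed volume (x - z) * (D x * u z))
      (volume.prod volume) := by
    refine (hD.mul_prod hu).bdd_mul (c := C) ?_ (Eventually.of_forall fun q => hC _)
    exact (φ.continuous_normed.comp (continuous_fst.sub continuous_snd)).aestronglyMeasurable
  have h2 : ∀ x, mollify φ u x * D x = ∫ z, φ.normed volume (x - z) * (D x * u z) := fun x => by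
    rw [mollify_apply', ← integral_mul_const]
    congr with z
    simp only [smul_eq_mul]; ring
  simp_rw [h2]
  rw [integral_integral_swap h1]
  congr with z
  rw [mollify_apply', ← integral_const_mul]
  congr with x
  rw [← φ.normed_neg, neg_sub, smul_eq_mul]
  ring

/-- The mollifier is moved onto the test field: it commutes with the divergence and preserves the
constraint `|ψ| ≤ 1`, so the new field is again admissible. -/
lemma totalVariation_mollify_le (φ : ContDiffBump (0 : Eucl N)) {u : Eucl N → ℝ}
    (hu : Integrable u) : totalVariation (mollify φ u) ≤ totalVariation u := by
  refine iSup₂_le fun ψ ⟨hψ, hψc, hψ1⟩ => ?_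
  have hψ' : ContDiff ℝ 1 ψ := hψ.of_le (by simp)
  rw [integral_mollify_mul φ hu ((continuous_divergence hψ').integrable_of_hasCompactSupport
    (hasCompactSupport_divergence hψc))]
  simp_rw [← divergence_mollify φ hψ' hψc]
  refine le_iSup₂_of_le (mollify φ ψ) ⟨contDiff_mollify φ hψ.continuous.locallyIntegrable, ?_,
    norm_mollify_le_one φ hψ1⟩ le_rfl
  exact HasCompactSupport.convolution _ φ.hasCompactSupport_normed hψc

/-- The ideal test field `-∇w/|∇w|` is neither smooth nor compactly supported. It is cut off by `χ
n`, and `|∇w|` in the denominator is replaced by `√(δ_n² + |∇w|²)`; Fatou removes both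
regularisations. -/
lemma lintegral_gradient_le_totalVariation {w : Eucl N → ℝ} (hw : ContDiff ℝ ∞ w) :
    ∫⁻ x, ‖gradient w x‖ₑ ≤ totalVariation w := by
  have hw1 : ContDiff ℝ 1 w := hw.of_le (by simp)
  have hg := contDiff_gradient hw
  have hgc := hg.continuous
  let χ : ℕ → ContDiffBump (0 : Eucl N) := fun n => ⟨n + 1, n + 2, by positivity, by linarith⟩
  let δ : ℕ → ℝ := fun n => 1 / ((n : ℝ) + 1)
  have hδ : ∀ n, 0 < δ n := fun n => by positivity
  let m : ℕ → Eucl N → ℝ := fun n x => √(δ n ^ 2 + ‖gradient w x‖ ^ 2)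
  have hm0 : ∀ n x, 0 < δ n ^ 2 + ‖gradient w x‖ ^ 2 := fun n x => by
    have := hδ n; positivity
  have hmp : ∀ n x, 0 < m n x := fun n x => Real.sqrt_pos.2 (hm0 n x)
  have hm : ∀ n, ContDiff ℝ ∞ (m n) := fun n =>
    (contDiff_const.add (hg.norm_sq ℝ)).sqrt fun x => (hm0 n x).ne'
  have hmle : ∀ n x, ‖gradient w x‖ ≤ m n x := fun n x =>
    Real.le_sqrt_of_sq_le (by have := sq_nonneg (δ n); linarith)
  let ψ : ℕ → Eucl N → Eucl N := fun n x => -((χ n x * (m n x)⁻¹) • gradient w x)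
  have hψ : ∀ n, ContDiff ℝ ∞ (ψ n) := fun n =>
    (((χ n).contDiff.mul ((hm n).inv fun x => (hmp n x).ne')).smul hg).neg
  have hψc : ∀ n, HasCompactSupport (ψ n) := fun n => by
    refine HasCompactSupport.of_support_subset_isCompact (isCompact_closedBall 0 (χ n).rOut) ?_
    intro x hx
    by_contra h
    refine hx ?_
    have : χ n x = 0 := (χ n).zero_of_le_dist (by
      rw [Metric.mem_closedBall] at h; exact (not_le.1 h).le)
    simp [ψ, this]
  have hψ1 : ∀ n x, ‖ψ n x‖ ≤ 1 := fun n x => by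
    simp only [ψ, norm_neg, norm_smul, norm_mul, norm_inv]
    rw [Real.norm_of_nonneg (χ n).nonneg, Real.norm_of_nonneg (hmp n x).le, mul_assoc]
    refine mul_le_one₀ (χ n).le_one (by positivity) ?_
    rw [inv_mul_le_one₀ (hmp n x)]
    exact hmle n x
  let q : ℕ → Eucl N → ℝ := fun n x => χ n x * (m n x)⁻¹ * ‖gradient w x‖ ^ 2
  have hq0 : ∀ n x, 0 ≤ q n x := fun n x => by
    have := hmp n x
    have := (χ n).nonneg (x := x)
    positivity
  have hinner : ∀ n x, inner ℝ (gradient w x) (ψ n x) = -q n x := fun n x => by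
    simp only [ψ, q, inner_neg_right, inner_smul_right, real_inner_self_eq_norm_sq]
  have hqc : ∀ n, Continuous (q n) := fun n => by
    have h : Continuous fun x => -inner ℝ (gradient w x) (ψ n x) :=
      (hgc.inner (hψ n).continuous).neg
    simpa only [hinner, neg_neg] using h
  have hle : ∀ n, ∫⁻ x, ENNReal.ofReal (q n x) ≤ totalVariation w := fun n => by
    have hqi : Integrable (q n) := by
      refine (hqc n).integrable_of_hasCompactSupport ?_
      have h : HasCompactSupport fun x => inner ℝ (gradient w x) (-ψ n x) :=
        (hψc n).mono fun x hx => by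
          contrapose! hx
          simp only [Function.mem_support, not_not] at hx ⊢
          simp [hx]
      simpa only [inner_neg_right, hinner, neg_neg] using h
    rw [← ofReal_integral_eq_lintegral_ofReal hqi (Eventually.of_forall (hq0 n))]
    refine le_iSup₂_of_le (ψ n) ⟨hψ n, hψc n, hψ1 n⟩ (le_of_eq ?_)
    rw [integral_mul_divergence hw1 ((hψ n).of_le (by simp)) (hψc n)]
    simp_rw [hinner, integral_neg, neg_neg]
  have hlim : ∀ x, Tendsto (fun n => ENNReal.ofReal (q n x)) atTop (𝓝 ‖gradient w x‖ₑ) := by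
    intro x
    rw [← ofReal_norm]
    refine ENNReal.tendsto_ofReal ?_
    have hχ : ∀ᶠ n in atTop, χ n x = 1 := by
      filter_upwards [eventually_ge_atTop ⌈‖x‖⌉₊] with n hn
      refine (χ n).one_of_mem_closedBall ?_
      rw [mem_closedBall_zero_iff]
      have : ‖x‖ ≤ n := (Nat.le_ceil _).trans (by exact_mod_cast hn)
      simp only [χ]; linarith
    rcases eq_or_ne (gradient w x) 0 with h0 | h0
    · simp [q, h0]
    · have hn : ‖gradient w x‖ ≠ 0 := norm_ne_zero_iff.2 h0
      have hmt : Tendsto (fun n => m n x) atTop (𝓝 ‖gradient w x‖) := by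
        have h := (((tendsto_one_div_add_atTop_nhds_zero_nat (𝕜 := ℝ)).pow 2).add_const
          (‖gradient w x‖ ^ 2)).sqrt
        simpa [m, δ, Real.sqrt_sq] using h
      have h := (hmt.inv₀ hn).mul_const (‖gradient w x‖ ^ 2)
      rw [show ‖gradient w x‖⁻¹ * ‖gradient w x‖ ^ 2 = ‖gradient w x‖ by field_simp] at h
      refine h.congr' ?_
      filter_upwards [hχ] with n hn
      simp [q, hn]
  calc ∫⁻ x, ‖gradient w x‖ₑ = ∫⁻ x, liminf (fun n => ENNReal.ofReal (q n x)) atTop := by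
        congr with x
        exact (hlim x).liminf_eq.symm
    _ ≤ liminf (fun n => ∫⁻ x, ENNReal.ofReal (q n x)) atTop :=
        lintegral_liminf_le fun n => (hqc n).measurable.ennreal_ofReal
    _ ≤ totalVariation w :=
        liminf_le_of_frequently_le' (Frequently.of_forall hle)

/-! ### Uniform convexity of `‖·‖ ^ p` -/

section UniformConvexity

variable {E : Type*} [NormedAddCommGroup E] [NormedSpace ℝ E] [StrictConvexSpace ℝ E]

/-- For equal norms strictness comes from strict convexity of the space, otherwise from that of `r ↦
r^p`. -/
lemma norm_midpoint_rpow_lt {p : ℝ} (hp : 1 < p) {a b : E} (hab : a ≠ b) :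
    ‖(1 / 2 : ℝ) • (a + b)‖ ^ p < (‖a‖ ^ p + ‖b‖ ^ p) / 2 := by
  have hp0 : 0 < p := by linarith
  by_cases h : ‖a‖ = ‖b‖
  · have h1 := (norm_midpoint_lt_iff h).2 hab
    rw [← h, add_self_div_two]
    exact Real.rpow_lt_rpow (norm_nonneg _) h1 hp0
  · have h1 : ‖(1 / 2 : ℝ) • (a + b)‖ ≤ 1 / 2 * ‖a‖ + 1 / 2 * ‖b‖ := by
      rw [norm_smul, Real.norm_of_nonneg (by norm_num), ← mul_add]
      gcongr
      exact norm_add_le a b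
    have h2 := (strictConvexOn_rpow hp).2 (norm_nonneg a) (norm_nonneg b) h
      (show (0 : ℝ) < 1 / 2 by norm_num) (show (0 : ℝ) < 1 / 2 by norm_num) (by norm_num)
    simp only [smul_eq_mul] at h2
    have h3 := Real.rpow_le_rpow (norm_nonneg _) h1 hp0.le
    linarith

lemma norm_midpoint_rpow_le {p : ℝ} (hp : 1 < p) (a b : E) :
    ‖(1 / 2 : ℝ) • (a + b)‖ ^ p ≤ (‖a‖ ^ p + ‖b‖ ^ p) / 2 := by
  rcases eq_or_ne a b with rfl | hab
  · rw [← two_smul ℝ a, smul_smul]; norm_num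
  · exact (norm_midpoint_rpow_lt hp hab).le

/-- A homogeneous form of the uniform convexity of `‖·‖ ^ p`, by compactness. -/
lemma exists_norm_sub_rpow_le [ProperSpace E] {p : ℝ} (hp : 1 < p) {θ : ℝ} (hθ : 0 < θ) :
    ∃ K : ℝ, 0 ≤ K ∧ ∀ a b : E, ‖a - b‖ ^ p + K * ‖(1 / 2 : ℝ) • (a + b)‖ ^ p ≤
      (θ + K / 2) * (‖a‖ ^ p + ‖b‖ ^ p) := by
  have hp0 : 0 < p := by linarith
  -- Normalised pairs that are not close. On this compact set the midpoint defect `Φ` has a positive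
  -- lower bound `δ`.
  let S : Set (E × E) := {q | ‖q.1‖ ^ p + ‖q.2‖ ^ p = 1 ∧ θ ≤ ‖q.1 - q.2‖ ^ p}
  let Φ : E × E → ℝ := fun q => (‖q.1‖ ^ p + ‖q.2‖ ^ p) / 2 - ‖(1 / 2 : ℝ) • (q.1 + q.2)‖ ^ p
  have hrc : Continuous fun r : ℝ => r ^ p := Real.continuous_rpow_const hp0.le
  have hΦc : Continuous Φ :=
    (((hrc.comp continuous_fst.norm).add (hrc.comp continuous_snd.norm)).div_const 2).sub
      (hrc.comp ((continuous_fst.add continuous_snd).const_smul (1 / 2 : ℝ)).norm)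
  have hΦ0 : ∀ a b, 0 ≤ Φ (a, b) := fun a b => sub_nonneg.2 (norm_midpoint_rpow_le hp a b)
  have hle1 : ∀ a b : E, ‖a‖ ^ p + ‖b‖ ^ p = 1 → ‖a‖ ≤ 1 ∧ ‖b‖ ≤ 1 := fun a b h => by
    have ha := Real.rpow_nonneg (norm_nonneg a) p
    have hb := Real.rpow_nonneg (norm_nonneg b) p
    constructor
    · by_contra! hc
      have := Real.one_lt_rpow hc hp0
      linarith
    · by_contra! hc
      have := Real.one_lt_rpow hc hp0
      linarith
  have hSc : IsCompact S := by
    refine Metric.isCompact_of_isClosed_isBounded (IsClosed.inter ?_ ?_) ?_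
    · exact isClosed_eq ((hrc.comp continuous_fst.norm).add (hrc.comp continuous_snd.norm))
        continuous_const
    · exact isClosed_le continuous_const (hrc.comp (continuous_fst.sub continuous_snd).norm)
    · refine (Metric.isBounded_closedBall (x := (0 : E × E)) (r := 1)).subset fun q hq => ?_
      rw [mem_closedBall_zero_iff, Prod.norm_def]
      exact max_le (hle1 _ _ hq.1).1 (hle1 _ _ hq.1).2
  obtain ⟨δ, hδ, hδS⟩ : ∃ δ : ℝ, 0 < δ ∧ ∀ q ∈ S, δ ≤ Φ q := by
    rcases S.eq_empty_or_nonempty with h | h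
    · exact ⟨1, one_pos, by simp [h]⟩
    · obtain ⟨q, hq, hmin⟩ := hSc.exists_isMinOn h hΦc.continuousOn
      refine ⟨Φ q, sub_pos.2 (norm_midpoint_rpow_lt hp fun h0 => ?_), fun x hx => hmin hx⟩
      have := hq.2
      rw [h0, sub_self, norm_zero, Real.zero_rpow hp0.ne'] at this
      linarith
  have hK : (0 : ℝ) ≤ 2 ^ p / δ := by positivity
  -- On `S` the left side is at most `2^p`, which `K = 2^p / δ` times the defect absorbs; off `S` it
  -- is below `θ`. General pairs then follow by homogeneity.
  have hunit : ∀ a b : E, ‖a‖ ^ p + ‖b‖ ^ p = 1 → ‖a - b‖ ^ p ≤ θ + 2 ^ p / δ * Φ (a, b) := by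
    intro a b h
    by_cases hS : θ ≤ ‖a - b‖ ^ p
    · have h1 : ‖a - b‖ ^ p ≤ 2 ^ p := by
        refine Real.rpow_le_rpow (norm_nonneg _) ?_ hp0.le
        have := hle1 a b h
        linarith [norm_sub_le a b]
      have h2 : 2 ^ p ≤ 2 ^ p / δ * Φ (a, b) := by
        rw [div_mul_eq_mul_div, le_div_iff₀ hδ]
        gcongr
        exact hδS (a, b) ⟨h, hS⟩
      linarith
    · have := mul_nonneg hK (hΦ0 a b)
      linarith
  refine ⟨2 ^ p / δ, hK, fun a b => ?_⟩
  set s := ‖a‖ ^ p + ‖b‖ ^ p with hs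
  have ha := Real.rpow_nonneg (norm_nonneg a) p
  have hb := Real.rpow_nonneg (norm_nonneg b) p
  rcases (add_nonneg ha hb).eq_or_lt with h0 | h0
  · have ha0 : ‖a‖ ^ p = 0 := by linarith
    have hb0 : ‖b‖ ^ p = 0 := by linarith
    rw [Real.rpow_eq_zero (norm_nonneg _) hp0.ne', norm_eq_zero] at ha0 hb0
    simp [hs, ha0, hb0, hp0.ne']
  · rw [← hs] at h0
    set r := s ^ (1 / p) with hr
    have hr0 : 0 < r := Real.rpow_pos_of_pos h0 _
    have hrp : r ^ p = s := by
      rw [hr, ← Real.rpow_mul h0.le, one_div, inv_mul_cancel₀ hp0.ne', Real.rpow_one]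
    have hscale : ∀ c : E, ‖r⁻¹ • c‖ ^ p = ‖c‖ ^ p / s := fun c => by
      rw [norm_smul, Real.mul_rpow (norm_nonneg _) (norm_nonneg _), norm_inv,
        Real.norm_of_nonneg hr0.le, Real.inv_rpow hr0.le, hrp, div_eq_inv_mul]
    have h1 := hunit (r⁻¹ • a) (r⁻¹ • b) (by rw [hscale, hscale, ← add_div, ← hs, div_self h0.ne'])
    simp only [Φ] at h1
    rw [← smul_sub, ← smul_add, smul_comm, hscale, hscale, hscale, hscale, ← add_div, ← hs,
      div_self h0.ne', div_le_iff₀ h0] at h1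
    have h2 : (θ + 2 ^ p / δ * (1 / 2 - ‖(1 / 2 : ℝ) • (a + b)‖ ^ p / s)) * s =
        (θ + 2 ^ p / δ / 2) * s - 2 ^ p / δ * ‖(1 / 2 : ℝ) • (a + b)‖ ^ p := by
      field_simp
      ring
    linarith

lemma exists_enorm_sub_rpow_le [ProperSpace E] {p : ℝ} (hp : 1 < p) {θ : ℝ} (hθ : 0 < θ) :
    ∃ K : ℝ, 0 ≤ K ∧ ∀ a b : E,
      ‖a - b‖ₑ ^ p + ENNReal.ofReal K * ‖(1 / 2 : ℝ) • (a + b)‖ₑ ^ p ≤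
        ENNReal.ofReal (θ + K / 2) * (‖a‖ₑ ^ p + ‖b‖ₑ ^ p) := by
  have hp0 : 0 < p := by linarith
  obtain ⟨K, hK, h⟩ := exists_norm_sub_rpow_le (E := E) hp hθ
  refine ⟨K, hK, fun a b => ?_⟩
  have he : ∀ c : E, ‖c‖ₑ ^ p = ENNReal.ofReal (‖c‖ ^ p) := fun c => by
    rw [← ofReal_norm, ENNReal.ofReal_rpow_of_nonneg (norm_nonneg _) hp0.le]
  simp_rw [he]
  rw [← ENNReal.ofReal_mul hK, ← ENNReal.ofReal_add (by positivity) (by positivity),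
    ← ENNReal.ofReal_add (by positivity) (by positivity), ← ENNReal.ofReal_mul (by positivity)]
  exact ENNReal.ofReal_le_ofReal (h a b)

end UniformConvexity

/-! ### Limits of pairings with test functions -/

lemma lintegral_enorm_rpow_eq {E : Type*} [NormedAddCommGroup E] {X : Type*} [MeasurableSpace X]
    {μ : Measure X} {p : ℝ} (hp : 1 ≤ p) (f : X → E) :
    ∫⁻ x, ‖f x‖ₑ ^ p ∂μ = eLpNorm f (ENNReal.ofReal p) μ ^ p := by
  have hp0 : 0 < p := by linarith
  rw [eLpNorm_eq_lintegral_rpow_enorm_toReal (by simpa using hp0) (by simp),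
    ENNReal.toReal_ofReal hp0.le, ← ENNReal.rpow_mul, one_div, inv_mul_cancel₀ hp0.ne',
    ENNReal.rpow_one]

lemma tendsto_integral_mul {P : ℝ≥0∞} (hP : 1 ≤ P) {f : ℕ → Eucl N → ℝ} {g : Eucl N → ℝ}
    (hf : ∀ n, LocallyIntegrable (f n)) (hg : LocallyIntegrable g)
    (h : Tendsto (fun n => eLpNorm (f n - g) P volume) atTop (𝓝 0)) {ψ : Eucl N → ℝ}
    (hψ : Continuous ψ) (hψc : HasCompactSupport ψ) :
    Tendsto (fun n => ∫ x, f n x * ψ x) atTop (𝓝 (∫ x, g x * ψ x)) := by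
  have hfi : ∀ n, Integrable fun x => f n x * ψ x := fun n => by
    simpa [mul_comm] using (hf n).integrable_smul_left_of_hasCompactSupport hψ hψc
  have hgi : Integrable fun x => g x * ψ x := by
    simpa [mul_comm] using hg.integrable_smul_left_of_hasCompactSupport hψ hψc
  refine tendsto_iff_edist_tendsto_0.2 ?_
  have : Fact (1 ≤ P) := ⟨hP⟩
  set Q := ENNReal.conjExponent P
  have hPQ : ENNReal.HolderConjugate P Q := ENNReal.HolderConjugate.conjExponent hP
  have hψQ : eLpNorm ψ Q volume ≠ ⊤ := (hψ.memLp_of_hasCompactSupport hψc).eLpNorm_ne_top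
  refine tendsto_of_tendsto_of_tendsto_of_le_of_le tendsto_const_nhds
    (h := fun n => eLpNorm (f n - g) P volume * eLpNorm ψ Q volume) ?_ (fun n => zero_le) ?_
  · simpa using ENNReal.Tendsto.mul_const h (Or.inr hψQ)
  · intro n
    dsimp only
    rw [edist_eq_enorm_sub, ← integral_sub (hfi n) hgi]
    refine (enorm_integral_le_lintegral_enorm _).trans ?_
    have h1 := eLpNorm_smul_le_mul_eLpNorm (p := P) (q := Q) (r := 1) (μ := volume)
      hψ.aestronglyMeasurable ((hf n).aestronglyMeasurable.sub hg.aestronglyMeasurable)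
    rw [eLpNorm_one_eq_lintegral_enorm] at h1
    refine (le_of_eq (lintegral_congr fun x => ?_)).trans h1
    simp [sub_mul]

/-! ### Lower semicontinuity of the Dirichlet energy along smooth approximations -/

lemma enorm_coord_le (v : Eucl N) (i : Fin N) : ‖v i‖ₑ ≤ ‖v‖ₑ := by
  rw [← ofReal_norm, ← ofReal_norm]
  exact ENNReal.ofReal_le_ofReal (PiLp.norm_apply_le v i)

/-- For a fixed test field, the pairing with `w n` is at most `∫ |∇w_n| ≤ b` and converges to the
pairing with `u`. -/
lemma totalVariation_le_of_tendsto {u : Eucl N → ℝ} (hu : LocallyIntegrable u)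
    {w : ℕ → Eucl N → ℝ} (hw : ∀ n, ContDiff ℝ ∞ (w n)) (h : TendstoLp 1 w u) {b : ℝ≥0∞}
    (hb : ∀ n, ∫⁻ x, ‖gradient (w n) x‖ₑ ≤ b) : totalVariation u ≤ b := by
  refine iSup₂_le fun ψ ⟨hψ, hψc, hψ1⟩ => ?_
  have hψ' : ContDiff ℝ 1 ψ := hψ.of_le (by simp)
  have h1 := tendsto_integral_mul (P := ENNReal.ofReal 1) (by simp)
    (fun n => (hw n).continuous.locallyIntegrable) hu h (continuous_divergence hψ')
    (hasCompactSupport_divergence hψc)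
  refine le_of_tendsto (ENNReal.tendsto_ofReal h1) (Eventually.of_forall fun n => ?_)
  rw [integral_mul_divergence ((hw n).of_le (by simp)) hψ' hψc, ← integral_neg]
  refine (ENNReal.ofReal_le_ofReal (le_abs_self _)).trans ?_
  rw [← Real.norm_eq_abs, ofReal_norm]
  refine (enorm_integral_le_lintegral_enorm _).trans (le_trans (lintegral_mono fun x => ?_) (hb n))
  rw [enorm_neg, ← ofReal_norm, ← ofReal_norm]
  refine ENNReal.ofReal_le_ofReal ((norm_inner_le_norm _ _).trans ?_)
  exact mul_le_of_le_one_right (norm_nonneg _) (hψ1 x)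

lemma gradient_midpoint {v w : Eucl N → ℝ} (hv : Differentiable ℝ v) (hw : Differentiable ℝ w)
    (x : Eucl N) : gradient (fun y => (1 / 2 : ℝ) * (v y + w y)) x =
      (1 / 2 : ℝ) • (gradient v x + gradient w x) := by
  have h : HasFDerivAt (fun y => (1 / 2 : ℝ) * (v y + w y))
      ((1 / 2 : ℝ) • (fderiv ℝ v x + fderiv ℝ w x)) x :=
    ((hv x).hasFDerivAt.add (hw x).hasFDerivAt).const_mul (1 / 2 : ℝ)
  simp only [gradient, h.fderiv, map_smul, map_add]

/-- A minimising sequence of smooth approximations whose gradients converge in `L^p`. -/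
lemma exists_tendsto_gradient {p : ℝ} (hp : 1 < p) {u : Eucl N → ℝ}
    (hu : AEStronglyMeasurable u volume)
    {w : ℕ → Eucl N → ℝ} (hw : ∀ n, ContDiff ℝ ∞ (w n)) (h : TendstoLp p w u) {b : ℝ≥0∞}
    (hb : b ≠ ⊤) (hwb : ∀ n, ∫⁻ x, ‖gradient (w n) x‖ₑ ^ p ≤ b) :
    ∃ (v : ℕ → Eucl N → ℝ) (G : Eucl N → Eucl N), (∀ n, ContDiff ℝ ∞ (v n)) ∧ TendstoLp p v u ∧
      MemLp G (ENNReal.ofReal p) volume ∧ ∫⁻ x, ‖G x‖ₑ ^ p ≤ b ∧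
      Tendsto (fun n => eLpNorm (gradient (v n) - G) (ENNReal.ofReal p) volume) atTop (𝓝 0) := by
  have hp0 : 0 < p := by linarith
  set P := ENNReal.ofReal p with hPdef
  have hP : Fact (1 ≤ P) := ⟨by simpa [P] using hp.le⟩
  let J : (Eucl N → ℝ) → ℝ≥0∞ := fun v => ∫⁻ x, ‖gradient v x‖ₑ ^ p
  let r : ℕ → ℝ≥0∞ := fun n => ((n : ℝ≥0∞) + 1)⁻¹
  have hr0 : ∀ n, 0 < r n := fun n => ENNReal.inv_pos.2 (by finiteness)
  have hrt : Tendsto r atTop (𝓝 0) := by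
    have := (tendsto_add_atTop_iff_nat 1).2 ENNReal.tendsto_inv_nat_nhds_zero
    simpa [r] using this
  have hra : Antitone r := fun m n hmn => by
    simp only [r]; gcongr
  -- The infima of the energy over these shrinking convex neighbourhoods of `u` increase to a limit
  -- `L ≤ b`, a relaxed energy at `u`; `v n` will be a near-minimiser in `A n`.
  let A : ℕ → Set (Eucl N → ℝ) := fun n => {v | ContDiff ℝ ∞ v ∧ eLpNorm (v - u) P volume ≤ r n}
  let I : ℕ → ℝ≥0∞ := fun n => ⨅ v ∈ A n, J v
  have hIb : ∀ n, I n ≤ b := fun n => by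
    obtain ⟨k, hk⟩ := (h.eventually (ge_mem_nhds (hr0 n))).exists
    exact (iInf₂_le (w k) ⟨hw k, hk⟩).trans (hwb k)
  have hIm : Monotone I := fun m n hmn =>
    le_iInf₂ fun v hv => iInf₂_le v ⟨hv.1, hv.2.trans (hra hmn)⟩
  set L := ⨆ n, I n with hL
  have hIL : Tendsto I atTop (𝓝 L) := tendsto_atTop_iSup hIm
  have hLb : L ≤ b := iSup_le hIb
  have hLt : L ≠ ⊤ := ne_top_of_le_ne_top hb hLb
  have hex : ∀ n, ∃ v ∈ A n, J v < I n + r n := fun n => by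
    have : I n < I n + r n := ENNReal.lt_add_right (ne_top_of_le_ne_top hb (hIb n)) (hr0 n).ne'
    simpa only [I, iInf_lt_iff, exists_prop] using this
  choose v hvA hvJ using hex
  have hvd : ∀ n, Differentiable ℝ (v n) := fun n => (hvA n).1.differentiable (by simp)
  have hvgc : ∀ n, Continuous (gradient (v n)) := fun n => (contDiff_gradient (hvA n).1).continuous
  have hJb : ∀ n M, M ≤ n → J (v n) ≤ L + r M := fun n M hM =>
    (hvJ n).le.trans (add_le_add (le_iSup I n) (hra hM))
  have hmem : ∀ n, MemLp (gradient (v n)) P volume := fun n => by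
    refine ⟨(hvgc n).aestronglyMeasurable, ?_⟩
    rw [eLpNorm_lt_top_iff_lintegral_rpow_enorm_lt_top (by simpa [P] using hp0) (by simp [P]),
      hPdef, ENNReal.toReal_ofReal hp0.le]
    refine (hJb n 0 (Nat.zero_le _)).trans_lt ?_
    simp only [r]
    finiteness
  -- By convexity the midpoint of `v n` and `v m` stays in `A M`, so its energy is at least `I M`.
  have hmid : ∀ n m M, M ≤ n → M ≤ m →
      I M ≤ ∫⁻ x, ‖(1 / 2 : ℝ) • (gradient (v n) x + gradient (v m) x)‖ₑ ^ p := by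
    intro n m M hn hm
    simp_rw [← gradient_midpoint (hvd n) (hvd m)]
    refine iInf₂_le (fun y => (1 / 2 : ℝ) * (v n y + v m y)) ⟨?_, ?_⟩
    · exact contDiff_const.mul ((hvA n).1.add (hvA m).1)
    · have h1 : (fun y => (1 / 2 : ℝ) * (v n y + v m y)) - u =
          (1 / 2 : ℝ) • ((v n - u) + (v m - u)) := by
        ext y
        simp only [Pi.sub_apply, Pi.smul_apply, Pi.add_apply, smul_eq_mul]; ring
      rw [h1, eLpNorm_const_smul]
      have h2 := eLpNorm_add_le (((hvA n).1.continuous.aestronglyMeasurable).sub hu)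
        (((hvA m).1.continuous.aestronglyMeasurable).sub hu) hP.out
      have h3 : ‖(1 / 2 : ℝ)‖ₑ = 2⁻¹ := by
        rw [Real.enorm_of_nonneg (by norm_num), one_div, ENNReal.ofReal_inv_of_pos (by norm_num)]
        simp
      calc ‖(1 / 2 : ℝ)‖ₑ * eLpNorm ((v n - u) + (v m - u)) P volume
          ≤ 2⁻¹ * (r M + r M) := by
            rw [h3]
            gcongr
            exact h2.trans (add_le_add ((hvA n).2.trans (hra hn)) ((hvA m).2.trans (hra hm)))
        _ = r M := by
            rw [← two_mul, ← mul_assoc, ENNReal.inv_mul_cancel (by simp) (by simp), one_mul]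
  have hcauchy : CauchySeq fun n => (hmem n).toLp (gradient (v n)) := by
    rw [EMetric.cauchySeq_iff]
    intro ε hε
    obtain ⟨e, he0, heε⟩ : ∃ e : ℝ, 0 < e ∧ ENNReal.ofReal e ≤ ε ^ p := by
      obtain ⟨e, he0, he⟩ := ENNReal.lt_iff_exists_nnreal_btwn.1
        (ENNReal.rpow_pos_of_nonneg hε hp0.le)
      exact ⟨e, by exact_mod_cast he0, by simpa using he.le⟩
    -- The bound `hD` below tends to `(θ + K/2) · 2L - K L = 2θL`, and this choice makes it smaller
    -- than `e`.
    set θ := e / (2 * L.toReal + 1) with hθ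
    have hθ0 : 0 < θ := by positivity
    obtain ⟨K, hK, hineq⟩ := exists_enorm_sub_rpow_le (E := Eucl N) hp hθ0
    have hD : ∀ n m M, M ≤ n → M ≤ m →
        ∫⁻ x, ‖gradient (v n) x - gradient (v m) x‖ₑ ^ p ≤
          ENNReal.ofReal (θ + K / 2) * ((L + r M) + (L + r M)) - ENNReal.ofReal K * I M := by
      intro n m M hn hm
      refine ENNReal.le_sub_of_add_le_right
        (ENNReal.mul_ne_top ENNReal.ofReal_ne_top (ne_top_of_le_ne_top hb (hIb M))) ?_
      have hgn := hvgc n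
      have hgm := hvgc m
      calc (∫⁻ x, ‖gradient (v n) x - gradient (v m) x‖ₑ ^ p) + ENNReal.ofReal K * I M
          ≤ (∫⁻ x, ‖gradient (v n) x - gradient (v m) x‖ₑ ^ p) + ENNReal.ofReal K *
            ∫⁻ x, ‖(1 / 2 : ℝ) • (gradient (v n) x + gradient (v m) x)‖ₑ ^ p := by
              gcongr; exact hmid n m M hn hm
        _ = ∫⁻ x, (‖gradient (v n) x - gradient (v m) x‖ₑ ^ p + ENNReal.ofReal K *
            ‖(1 / 2 : ℝ) • (gradient (v n) x + gradient (v m) x)‖ₑ ^ p) := by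
              rw [lintegral_add_left (by fun_prop), lintegral_const_mul _ (by fun_prop)]
        _ ≤ ∫⁻ x, ENNReal.ofReal (θ + K / 2) *
            (‖gradient (v n) x‖ₑ ^ p + ‖gradient (v m) x‖ₑ ^ p) :=
              lintegral_mono fun x => hineq _ _
        _ = ENNReal.ofReal (θ + K / 2) * (J (v n) + J (v m)) := by
              rw [lintegral_const_mul _ (by fun_prop), lintegral_add_left (by fun_prop)]
        _ ≤ _ := by
              gcongr
              · exact hJb n M hn
              · exact hJb m M hm
    have hlim : Tendsto (fun M => ENNReal.ofReal (θ + K / 2) * ((L + r M) + (L + r M)) -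
        ENNReal.ofReal K * I M) atTop
        (𝓝 (ENNReal.ofReal (θ + K / 2) * ((L + 0) + (L + 0)) - ENNReal.ofReal K * L)) := by
      have h1 : Tendsto (fun M => L + r M) atTop (𝓝 (L + 0)) := tendsto_const_nhds.add hrt
      refine ENNReal.Tendsto.sub (ENNReal.Tendsto.const_mul (h1.add h1)
        (Or.inr ENNReal.ofReal_ne_top)) (ENNReal.Tendsto.const_mul hIL
        (Or.inr ENNReal.ofReal_ne_top)) (Or.inl ?_)
      finiteness
    have hlt : ENNReal.ofReal (θ + K / 2) * ((L + 0) + (L + 0)) - ENNReal.ofReal K * L <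
        ENNReal.ofReal e := by
      have hL0 : 0 ≤ L.toReal := ENNReal.toReal_nonneg
      rw [← ENNReal.ofReal_toReal hLt, add_zero, ← ENNReal.ofReal_add hL0 hL0,
        ← ENNReal.ofReal_mul (by positivity), ← ENNReal.ofReal_mul hK,
        ← ENNReal.ofReal_sub _ (by positivity)]
      refine (ENNReal.ofReal_lt_ofReal_iff he0).2 ?_
      have h1 : θ * (2 * L.toReal + 1) = e := by rw [hθ]; field_simp
      nlinarith
    obtain ⟨M, hM⟩ := (hlim.eventually (gt_mem_nhds hlt)).exists
    refine ⟨M, fun n hn m hm => ?_⟩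
    rw [Lp.edist_toLp_toLp, ← ENNReal.rpow_lt_rpow_iff hp0, ← lintegral_enorm_rpow_eq hp.le]
    exact ((hD n m M hn hm).trans_lt hM).trans_le heε
  obtain ⟨G, hG⟩ := cauchySeq_tendsto_of_complete hcauchy
  have hGe : Tendsto (fun n => eLpNorm (gradient (v n) - ⇑G) P volume) atTop (𝓝 0) := by
    have h1 := tendsto_iff_edist_tendsto_0.1 hG
    refine h1.congr fun n => ?_
    rw [Lp.edist_def]
    exact eLpNorm_congr_ae ((hmem n).coeFn_toLp.sub (ae_eq_refl _))
  refine ⟨v, G, fun n => (hvA n).1, ?_, Lp.memLp G, ?_, hGe⟩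
  · exact tendsto_of_tendsto_of_tendsto_of_le_of_le tendsto_const_nhds hrt (fun n => zero_le)
      fun n => (hvA n).2
  · rw [lintegral_enorm_rpow_eq hp.le, ← hPdef]
    have h1 : Tendsto (fun n => ‖(hmem n).toLp (gradient (v n))‖ₑ ^ p) atTop (𝓝 (‖G‖ₑ ^ p)) :=
      (hG.enorm).ennrpow_const p
    have h2 : ‖G‖ₑ = eLpNorm G P volume := Lp.enorm_def G
    rw [← h2]
    refine le_trans (le_of_tendsto_of_tendsto h1 (hIL.add hrt) (Eventually.of_forall fun n => ?_))
      (by simpa using hLb)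
    dsimp only
    rw [Lp.enorm_toLp, hPdef, ← lintegral_enorm_rpow_eq hp.le]
    exact (hvJ n).le

lemma isWeakGradient_of_tendsto {P : ℝ≥0∞} (hP : 1 ≤ P) {u : Eucl N → ℝ}
    (hu : LocallyIntegrable u) {G : Eucl N → Eucl N} (hG : LocallyIntegrable G)
    {w : ℕ → Eucl N → ℝ} (hw : ∀ n, ContDiff ℝ ∞ (w n))
    (hwu : Tendsto (fun n => eLpNorm (w n - u) P volume) atTop (𝓝 0))
    (hwG : Tendsto (fun n => eLpNorm (gradient (w n) - G) P volume) atTop (𝓝 0)) :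
    IsWeakGradient u G := by
  refine ⟨hu, hG, fun φ hφ hφc i => ?_⟩
  have hφ1 : ContDiff ℝ 1 φ := hφ.of_le (by simp)
  have hgc : ∀ n, Continuous fun x => gradient (w n) x i := fun n => by
    have := (contDiff_gradient (hw n)).continuous
    fun_prop
  have hGi : LocallyIntegrable fun x => G x i := fun x => by
    obtain ⟨s, hs, hsG⟩ := hG x
    exact ⟨s, hs, (EuclideanSpace.proj i : Eucl N →L[ℝ] ℝ).integrable_comp hsG⟩
  have h1 := tendsto_integral_mul hP (fun n => (hw n).continuous.locallyIntegrable) hu hwu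
    ((hφ1.continuous_fderiv one_ne_zero).clm_apply
      (continuous_const (y := EuclideanSpace.single i (1 : ℝ)))) (hφc.fderiv_apply ℝ _)
  have h2 := tendsto_integral_mul hP (f := fun n x => gradient (w n) x i)
    (g := fun x => G x i) (fun n => (hgc n).locallyIntegrable) hGi
    (tendsto_of_tendsto_of_tendsto_of_le_of_le tendsto_const_nhds hwG (fun n => zero_le)
      fun n => eLpNorm_mono_enorm fun x => enorm_coord_le (gradient (w n) x - G x) i)
    hφ.continuous hφc
  refine tendsto_nhds_unique h1 (h2.neg.congr fun n => ?_)
  rw [integral_mul_fderiv_eq_neg_gradient ((hw n).of_le (by simp)) hφ1 hφc]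

/-- For `p = 1` the limit gradient may be a singular measure, so the dual formula is used; for `p >
1` a gradient in `L^p` must be produced, by strong convergence of gradients. -/
lemma sobBV_of_tendsto {p : ℝ} (hp : 1 ≤ p) {u : Eucl N → ℝ}
    (hu : MemLp u (ENNReal.ofReal p) volume) {w : ℕ → Eucl N → ℝ} (hw : ∀ n, ContDiff ℝ ∞ (w n))
    (h : TendstoLp p w u) {b : ℝ≥0∞} (hb : b ≠ ⊤)
    (hwb : ∀ n, ∫⁻ x, ‖gradient (w n) x‖ₑ ^ p ≤ b) : u ∈ sobBV N p ∧ gradEnergy p u ≤ b := by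
  have hP : 1 ≤ ENNReal.ofReal p := by simpa using hp
  have hul := hu.locallyIntegrable hP
  rcases hp.eq_or_lt with rfl | hp1
  · simp only [sobBV, gradEnergy, if_true, bvSpace]
    have h1 := totalVariation_le_of_tendsto hul hw h (by simpa using hwb)
    exact ⟨⟨by simpa using hu, h1.trans_lt hb.lt_top⟩, h1⟩
  · simp only [sobBV, gradEnergy, hp1.ne', if_false, sobolevSpace]
    obtain ⟨v, G, hv, hvu, hG, hGb, hvG⟩ :=
      exists_tendsto_gradient hp1 hu.aestronglyMeasurable hw h hb hwb
    have hwg := isWeakGradient_of_tendsto hP hul (hG.locallyIntegrable hP) hv hvu hvG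
    exact ⟨⟨hu, G, hwg, hG⟩, (iInf₂_le G hwg).trans hGb⟩

/-! ### The heat energies are bounded by the Dirichlet energy, which is their supremum -/

lemma memLp_of_mem_sobBV {p : ℝ} {u : Eucl N → ℝ} (hu : u ∈ sobBV N p) :
    MemLp u (ENNReal.ofReal p) volume := by
  unfold sobBV at hu
  split_ifs at hu with h
  · subst h
    simpa using hu.1
  · exact hu.1

lemma lintegral_gradient_mollify_le_gradEnergy {p : ℝ} (hp : 1 ≤ p) (φ : ContDiffBump (0 : Eucl N))
    {u : Eucl N → ℝ} (hu : u ∈ sobBV N p) :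
    ∫⁻ x, ‖gradient (mollify φ u) x‖ₑ ^ p ≤ gradEnergy p u := by
  unfold gradEnergy
  split_ifs with h
  · subst h
    simp only [sobBV, if_true, bvSpace] at hu
    have hui : Integrable u := memLp_one_iff_integrable.1 hu.1
    simp only [ENNReal.rpow_one]
    exact (lintegral_gradient_le_totalVariation (contDiff_mollify φ hui.locallyIntegrable)).trans
      (totalVariation_mollify_le φ hui)
  · exact le_iInf₂ fun G hG => lintegral_gradient_mollify_le_of_isWeakGradient hp φ hG

/-- Mollifications satisfy the bound with the energy of `u` on the right; Fatou at the fixed time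
`t` passes it to `u`. -/
lemma heatEnergy_le_gradEnergy {p : ℝ} (hp : 1 ≤ p) {u : Eucl N → ℝ} (hu : u ∈ sobBV N p) {t : ℝ}
    (ht : 0 < t) : heatEnergy p t u ≤
      ENNReal.ofReal (2 * Real.Gamma p / Real.Gamma (p / 2)) * gradEnergy p u := by
  have hul := (memLp_of_mem_sobBV hu).locallyIntegrable (by simpa using hp)
  have hε : ∀ n : ℕ, 0 < 1 / ((n : ℝ) + 1) := fun n => by positivity
  refine heatEnergy_le_of_ae_tendsto hp
    (u := fun n => mollify (stdBump N _ (hε n)) u) (s := fun _ => t)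
    (fun n => (contDiff_mollify _ hul).continuous.measurable)
    (ae_tendsto_mollify hul hε tendsto_one_div_add_atTop_nhds_zero_nat) ht tendsto_const_nhds
    (Eventually.of_forall fun n => ?_)
  refine (heatEnergy_le_of_contDiff hp ((contDiff_mollify _ hul).of_le (by simp)) ht).trans ?_
  gcongr
  exact lintegral_gradient_mollify_le_gradEnergy hp _ hu

lemma tendstoLp_mollify {p : ℝ} (hp : 1 ≤ p) {u : Eucl N → ℝ} (hum : Measurable u)
    (hu : LocallyIntegrable u) {a : ℝ≥0∞} (hat : a ≠ ⊤) (ha : ∀ s, 0 < s → heatEnergy p s u ≤ a)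
    {ε : ℕ → ℝ} (hε : ∀ n, 0 < ε n) (hε0 : Tendsto ε atTop (𝓝 0)) :
    TendstoLp p (fun n => mollify (stdBump N (ε n) (hε n)) u) u := by
  have hp0 : 0 < p := by linarith
  have h1 : Tendsto (fun n => ENNReal.ofReal (bumpConst N * (ε n ^ 2) ^ (p / 2)) * a) atTop
      (𝓝 0) := by
    have h2 : Tendsto (fun n => bumpConst N * (ε n ^ 2) ^ (p / 2)) atTop (𝓝 0) := by
      have := ((hε0.pow 2).rpow_const (p := p / 2) (Or.inr (by positivity))).const_mul (bumpConst N)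
      simpa [hp0.ne'] using this
    simpa using ENNReal.Tendsto.mul_const (ENNReal.tendsto_ofReal h2) (Or.inr hat)
  have h3 : Tendsto (fun n => ∫⁻ x, ‖mollify (stdBump N (ε n) (hε n)) u x - u x‖ₑ ^ p) atTop
      (𝓝 0) := by
    refine tendsto_of_tendsto_of_tendsto_of_le_of_le tendsto_const_nhds h1 (fun n => zero_le)
      fun n => ?_
    have hpos := pow_pos (hε n) 2
    refine (lintegral_enorm_mollify_sub_rpow_le hp hum hu (hε n) (by linarith) le_rfl).trans ?_
    gcongr
    exact ha _ hpos
  have h4 := h3.ennrpow_const p⁻¹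
  rw [ENNReal.zero_rpow_of_pos (inv_pos.2 hp0)] at h4
  refine h4.congr fun n => ?_
  have := lintegral_enorm_rpow_eq (μ := volume) hp (mollify (stdBump N (ε n) (hε n)) u - u)
  simp only [Pi.sub_apply] at this
  rw [this, ENNReal.rpow_rpow_inv hp0.ne']

/-- Mollifications inherit the bound `a` on all heat energies, so their Dirichlet energies are at
most `a / c`. They converge to `u` in `L^p` at the rate given by the same bound, and the Dirichlet
energy is lower semicontinuous along them. -/
lemma mem_sobBV_and_gradEnergy_le {p : ℝ} (hp : 1 ≤ p) {u : Eucl N → ℝ}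
    (hu : MemLp u (ENNReal.ofReal p) volume) {a : ℝ≥0∞} (hat : a ≠ ⊤)
    (ha : ∀ s, 0 < s → heatEnergy p s u ≤ a) : u ∈ sobBV N p ∧
      ENNReal.ofReal (2 * Real.Gamma p / Real.Gamma (p / 2)) * gradEnergy p u ≤ a := by
  set c := ENNReal.ofReal (2 * Real.Gamma p / Real.Gamma (p / 2))
  have hc0 : c ≠ 0 := by simpa [c] using gaussianConst_pos hp
  have hct : c ≠ ⊤ := ENNReal.ofReal_ne_top
  obtain ⟨u', hu'm, huu'⟩ := hu.aestronglyMeasurable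
  have hu' : MemLp u' (ENNReal.ofReal p) volume := (memLp_congr_ae huu').1 hu
  have hul := hu'.locallyIntegrable (by simpa using hp)
  have ha' : ∀ s, 0 < s → heatEnergy p s u' ≤ a := fun s hs =>
    (heatEnergy_congr_ae p s huu').symm.trans_le (ha s hs)
  have hε : ∀ n : ℕ, 0 < 1 / ((n : ℝ) + 1) := fun n => by positivity
  have h1 := tendstoLp_mollify hp hu'm.measurable hul hat ha' hε
    tendsto_one_div_add_atTop_nhds_zero_nat
  have h2 : TendstoLp p (fun n : ℕ => mollify (stdBump N _ (hε n)) u') u := by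
    refine h1.congr fun n => eLpNorm_congr_ae ?_
    exact (ae_eq_refl _).sub huu'.symm
  have h3 := sobBV_of_tendsto hp hu (fun n => contDiff_mollify _ hul) h2
    (b := a / c) (ENNReal.div_ne_top hat hc0) fun n => by
      rw [ENNReal.le_div_iff_mul_le (Or.inl hc0) (Or.inl hct), mul_comm]
      exact gradEnergy_le_of_contDiff hp ((contDiff_mollify _ hul).of_le (by simp)) fun s hs =>
        (heatEnergy_mollify_le hp _ hu'm.measurable hul s).trans (ha' s hs)
  refine ⟨h3.1, ?_⟩
  rw [mul_comm, ← ENNReal.le_div_iff_mul_le (Or.inl hc0) (Or.inl hct)]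
  exact h3.2

/-! ### Lower semicontinuity along `L^p_loc` convergent sequences -/

lemma TendstoLpLoc.aestronglyMeasurable {p : ℝ} {u : ℕ → Eucl N → ℝ} {v : Eucl N → ℝ}
    (h : TendstoLpLoc p u v) : AEStronglyMeasurable v volume := by
  rw [← Measure.restrict_univ (μ := (volume : Measure (Eucl N))),
    ← Metric.iUnion_closedBall_nat (0 : Eucl N), aestronglyMeasurable_iUnion_iff]
  exact fun n => (h _ (isCompact_closedBall 0 n)).1.aestronglyMeasurable

lemma TendstoLpLoc.comp {p : ℝ} {u : ℕ → Eucl N → ℝ} {v : Eucl N → ℝ}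
    (h : TendstoLpLoc p u v) {φ : ℕ → ℕ} (hφ : StrictMono φ) :
    TendstoLpLoc p (fun n => u (φ n)) v :=
  fun K hK => ⟨(h K hK).1, (h K hK).2.comp hφ.tendsto_atTop⟩

lemma TendstoLp.tendstoLpLoc {p : ℝ} {u : ℕ → Eucl N → ℝ} {v : Eucl N → ℝ}
    (h : TendstoLp p u v) (hv : MemLp v (ENNReal.ofReal p) volume) : TendstoLpLoc p u v :=
  fun _ _ => ⟨hv.restrict _, tendsto_of_tendsto_of_tendsto_of_le_of_le tendsto_const_nhds h
    (fun _ => zero_le) fun _ => eLpNorm_mono_measure _ Measure.restrict_le_self⟩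

/-- The `n`-th index makes the error on the ball of radius `n` at most `2^{-n}`. The errors are then
summable almost everywhere, and each point lies in all but finitely many of the balls. -/
lemma TendstoLpLoc.exists_subseq_tendsto_ae {p : ℝ} (hp : 1 ≤ p) {u : ℕ → Eucl N → ℝ}
    {v : Eucl N → ℝ} (hu : ∀ k, AEStronglyMeasurable (u k) volume) (h : TendstoLpLoc p u v) :
    ∃ ψ : ℕ → ℕ, StrictMono ψ ∧ ∀ᵐ x, Tendsto (fun n => u (ψ n) x) atTop (𝓝 (v x)) := by
  have hp0 : 0 < p := by linarith
  have hv := h.aestronglyMeasurable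
  have h1 : ∀ n : ℕ, ∀ᶠ k in atTop,
      ∫⁻ x in Metric.closedBall (0 : Eucl N) n, ‖u k x - v x‖ₑ ^ p ≤ 2⁻¹ ^ n := fun n => by
    have h2 := ((h _ (isCompact_closedBall 0 n)).2).ennrpow_const p
    rw [ENNReal.zero_rpow_of_pos hp0] at h2
    filter_upwards [h2.eventually (ge_mem_nhds
      (show (0 : ℝ≥0∞) < 2⁻¹ ^ n from ENNReal.pow_pos (by simp) n))] with k hk
    rw [← lintegral_enorm_rpow_eq hp] at hk
    exact hk
  obtain ⟨ψ, hψ, hψ1⟩ := extraction_forall_of_eventually h1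
  refine ⟨ψ, hψ, ?_⟩
  let F : ℕ → Eucl N → ℝ≥0∞ := fun n =>
    (Metric.closedBall (0 : Eucl N) n).indicator fun x => ‖u (ψ n) x - v x‖ₑ ^ p
  have hFm : ∀ n, AEMeasurable (F n) volume := fun n =>
    (((hu (ψ n)).sub hv).enorm.pow_const p).indicator Metric.isClosed_closedBall.measurableSet
  have hsum : ∫⁻ x, ∑' n, F n x ≠ ⊤ := by
    rw [lintegral_tsum hFm]
    refine ne_top_of_le_ne_top ?_ (ENNReal.tsum_le_tsum fun n => ?_)
      (b := ∑' n : ℕ, (2⁻¹ : ℝ≥0∞) ^ n)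
    · rw [ENNReal.tsum_geometric, ENNReal.one_sub_inv_two]; simp
    · simp only [F]
      rw [lintegral_indicator Metric.isClosed_closedBall.measurableSet]
      exact hψ1 n
  filter_upwards [ae_lt_top' (AEMeasurable.tsum hFm) hsum] with x hx
  have h3 := ENNReal.tendsto_atTop_zero_of_tsum_ne_top hx.ne
  have h4 : Tendsto (fun n => ‖u (ψ n) x - v x‖ₑ ^ p) atTop (𝓝 0) := by
    refine h3.congr' ?_
    filter_upwards [eventually_ge_atTop ⌈‖x‖⌉₊] with n hn
    refine Set.indicator_of_mem ?_ _
    rw [mem_closedBall_zero_iff]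
    exact (Nat.le_ceil _).trans (by exact_mod_cast hn)
  have h5 := h4.ennrpow_const p⁻¹
  rw [ENNReal.zero_rpow_of_pos (inv_pos.2 hp0)] at h5
  refine tendsto_iff_edist_tendsto_0.2 (h5.congr fun n => ?_)
  rw [ENNReal.rpow_rpow_inv hp0.ne', edist_eq_enorm_sub]

lemma TendstoLpLoc.memLp {p : ℝ} (hp : 1 ≤ p) {u : ℕ → Eucl N → ℝ} {v : Eucl N → ℝ}
    (hu : ∀ k, AEStronglyMeasurable (u k) volume) (h : TendstoLpLoc p u v) {C : ℝ≥0∞}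
    (hCt : C ≠ ⊤) (hC : ∀ k, eLpNorm (u k) (ENNReal.ofReal p) volume ≤ C) :
    MemLp v (ENNReal.ofReal p) volume := by
  obtain ⟨ψ, -, hψ⟩ := h.exists_subseq_tendsto_ae hp hu
  refine ⟨h.aestronglyMeasurable, ?_⟩
  refine (Lp.eLpNorm_lim_le_liminf_eLpNorm (fun n => hu (ψ n)) v hψ).trans_lt ?_
  exact (liminf_le_of_frequently_le' (Frequently.of_forall fun n => hC (ψ n))).trans_lt hCt.lt_top

lemma heatEnergy_le_of_tendsto_zero {p : ℝ} (hp : 1 ≤ p) {u : ℕ → Eucl N → ℝ}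
    {v : Eucl N → ℝ} (hu : ∀ k, AEStronglyMeasurable (u k) volume)
    (huv : ∀ᵐ x, Tendsto (fun k => u k x) atTop (𝓝 (v x))) {t : ℕ → ℝ} (ht : ∀ k, 0 < t k)
    (ht0 : Tendsto t atTop (𝓝 0)) {a : ℝ≥0∞} (ha : ∀ k, heatEnergy p (t k) (u k) ≤ a) {s : ℝ}
    (hs : 0 < s) : heatEnergy p s v ≤ a := by
  refine heatEnergy_le_of_ae_tendsto_of_tendsto_zero hp (u := fun k => (hu k).mk (u k))
    (fun k => (hu k).stronglyMeasurable_mk.measurable) ?_ ht ht0 (fun k => ?_) hs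
  · filter_upwards [huv, ae_all_iff.2 fun k => (hu k).ae_eq_mk] with x hx hxk
    exact hx.congr fun k => hxk k
  · rw [← heatEnergy_congr_ae p (t k) (hu k).ae_eq_mk]
    exact ha k

/-- For `a` above the lower limit, a subsequence has energies below `a`, and a further one converges
almost everywhere; its bound at vanishing times carries over to the time `s`. -/
lemma heatEnergy_le_liminf {p : ℝ} (hp : 1 ≤ p) {u : ℕ → Eucl N → ℝ} {v : Eucl N → ℝ}
    (hu : ∀ k, AEStronglyMeasurable (u k) volume) (h : TendstoLpLoc p u v) {t : ℕ → ℝ}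
    (ht : ∀ k, 0 < t k) (ht0 : Tendsto t atTop (𝓝 0)) {s : ℝ} (hs : 0 < s) :
    heatEnergy p s v ≤ liminf (fun k => heatEnergy p (t k) (u k)) atTop := by
  refine le_of_forall_gt_imp_ge_of_dense fun a ha => ?_
  obtain ⟨φ, hφ, hφa⟩ := extraction_of_frequently_atTop (frequently_lt_of_liminf_lt
    (by isBoundedDefault) ha)
  obtain ⟨ψ, hψ, hψv⟩ := (h.comp hφ).exists_subseq_tendsto_ae hp fun n => hu (φ n)
  exact heatEnergy_le_of_tendsto_zero hp (fun n => hu (φ (ψ n))) hψv (fun n => ht (φ (ψ n)))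
    (ht0.comp (hφ.comp hψ).tendsto_atTop) (fun n => (hφa (ψ n)).le) hs

lemma mem_sobBV_and_gradEnergy_le_liminf {p : ℝ} (hp : 1 ≤ p) {u : ℕ → Eucl N → ℝ}
    {v : Eucl N → ℝ} (hu : ∀ k, AEStronglyMeasurable (u k) volume)
    (hv : MemLp v (ENNReal.ofReal p) volume) (h : TendstoLpLoc p u v) {t : ℕ → ℝ}
    (ht : Infinitesimal t) (hfin : liminf (fun k => heatEnergy p (t k) (u k)) atTop ≠ ⊤) :
    v ∈ sobBV N p ∧ ENNReal.ofReal (2 * Real.Gamma p / Real.Gamma (p / 2)) * gradEnergy p v ≤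
      liminf (fun k => heatEnergy p (t k) (u k)) atTop :=
  mem_sobBV_and_gradEnergy_le hp hv hfin fun _ hs =>
    heatEnergy_le_liminf hp hu h (fun k => (ht.1 k).1) ht.2 hs

/-- The upper bound holds at every time. If `E_t(u) ≤ a` along times tending to `0`, with `a` below
the claimed limit, lower semicontinuity for the constant sequence `u` gives a contradiction. -/
lemma tendsto_heatEnergy {p : ℝ} (hp : 1 ≤ p) {u : Eucl N → ℝ} (hu : u ∈ sobBV N p) :
    Tendsto (fun t : ℝ => heatEnergy p t u) (𝓝[>] 0)
      (𝓝 (ENNReal.ofReal (2 * Real.Gamma p / Real.Gamma (p / 2)) * gradEnergy p u)) := by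
  have hup := memLp_of_mem_sobBV hu
  refine tendsto_order.2 ⟨fun a ha => ?_, fun a ha => ?_⟩
  · by_contra hcon
    rw [not_eventually] at hcon
    obtain ⟨t, ht, hta⟩ := exists_seq_forall_of_frequently
      (hcon.and_eventually self_mem_nhdsWithin)
    refine ha.not_ge (mem_sobBV_and_gradEnergy_le hp hup ha.ne_top fun s hs => ?_).2
    exact heatEnergy_le_of_tendsto_zero hp (u := fun _ => u)
      (fun _ => hup.aestronglyMeasurable) (Eventually.of_forall fun x => tendsto_const_nhds)
      (fun n => (hta n).2) (tendsto_nhds_of_tendsto_nhdsWithin ht)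
      (fun n => not_lt.1 (hta n).1) hs
  · filter_upwards [self_mem_nhdsWithin] with t ht
    exact (heatEnergy_le_gradEnergy hp hu ht).trans_lt ha

/-! ### Compactness -/

/-- Arzelà–Ascoli in finite form: the values at finitely many points form a bounded, hence totally
bounded, set in a finite-dimensional space, and the Lipschitz bound controls the rest. The errors
sum to `3δ/4`. -/
lemma exists_finite_net_of_lipschitz {K : Set (Eucl N)} (hK : IsCompact K)
    {g : ℕ → Eucl N → ℝ} {M Λ : ℝ} (hM : ∀ k, ∀ x ∈ K, |g k x| ≤ M)
    (hΛ : ∀ k, ∀ x ∈ K, ∀ y ∈ K, |g k x - g k y| ≤ Λ * ‖x - y‖) {δ : ℝ} (hδ : 0 < δ) :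
    ∃ T : Set ℕ, T.Finite ∧ ∀ k, ∃ i ∈ T, ∀ x ∈ K, |g k x - g i x| ≤ δ := by
  set r := δ / (4 * (|Λ| + 1)) with hr
  have hr0 : 0 < r := by positivity
  obtain ⟨F, hFK, hF, hcov⟩ := hK.finite_cover_balls hr0
  have : Fintype F := hF.fintype
  let V : ℕ → F → ℝ := fun k x => g k x
  have hV : TotallyBounded (Set.range V) := by
    refine (isCompact_closedBall (0 : F → ℝ) (max M 0)).totallyBounded.subset ?_
    rintro _ ⟨k, rfl⟩
    rw [mem_closedBall_zero_iff, pi_norm_le_iff_of_nonneg (le_max_right _ _)]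
    exact fun x => (hM k x (hFK x.2)).trans (le_max_left _ _)
  obtain ⟨T, -, hT, hTcov⟩ := Set.exists_subset_image_finite_and.1 (by
    rw [← Set.image_univ] at hV
    exact Metric.finite_approx_of_totallyBounded hV (δ / 4) (by positivity))
  refine ⟨T, hT, fun k => ?_⟩
  obtain ⟨_, ⟨i, hiT, rfl⟩, hy⟩ := Set.mem_iUnion₂.1
    (hTcov (Set.mem_image_of_mem V (Set.mem_univ k)))
  refine ⟨i, hiT, fun x hx => ?_⟩
  obtain ⟨z, hzF, hz⟩ := Set.mem_iUnion₂.1 (hcov hx)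
  have hzK := hFK hzF
  have h1 : |g k z - g i z| < δ / 4 := by
    have := (dist_pi_lt_iff (by positivity)).1 (Metric.mem_ball.1 hy) ⟨z, hzF⟩
    simpa [V, Real.dist_eq] using this
  have h2 : ∀ j, |g j x - g j z| ≤ δ / 4 := fun j => by
    refine (hΛ j x hx z hzK).trans ?_
    have h3 : ‖x - z‖ ≤ r := by rw [← dist_eq_norm]; exact (Metric.mem_ball.1 hz).le
    calc Λ * ‖x - z‖ ≤ (|Λ| + 1) * r := by
          gcongr
          linarith [le_abs_self Λ]
      _ = δ / 4 := by rw [hr]; field_simp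
  have h4 := h2 k
  have h5 := h2 i
  rw [abs_le] at h4 h5 ⊢
  rw [abs_lt] at h1
  constructor <;> linarith

/-- Both mollifiers, centred at `x` and `y`, are supported in the ball of radius `R`, so only the
local `L^1` norm of `u` enters. -/
lemma norm_mollify_sub_le (φ : ContDiffBump (0 : Eucl N)) {u : Eucl N → ℝ}
    (hu : LocallyIntegrable u) {Λ : ℝ}
    (hΛ : ∀ x y, |φ.normed volume x - φ.normed volume y| ≤ Λ * ‖x - y‖) {R : ℝ} {x y : Eucl N}
    (hx : ‖x‖ + φ.rOut ≤ R) (hy : ‖y‖ + φ.rOut ≤ R) :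
    |mollify φ u x - mollify φ u y| ≤
      Λ * ‖x - y‖ * ∫ z in Metric.closedBall (0 : Eucl N) R, ‖u z‖ := by
  have hzero : ∀ x z : Eucl N, ‖x‖ + φ.rOut ≤ R → z ∉ Metric.closedBall (0 : Eucl N) R →
      φ.normed volume (x - z) = 0 := fun x z hx hz => by
    rw [← Function.notMem_support, ContDiffBump.support_normed_eq, mem_ball_zero_iff, not_lt]
    rw [mem_closedBall_zero_iff, not_le] at hz
    have := norm_sub_norm_le z x
    rw [norm_sub_rev] at this
    linarith
  have hui : IntegrableOn (fun z => ‖u z‖) (Metric.closedBall 0 R) :=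
    (hu.integrableOn_isCompact (isCompact_closedBall 0 R)).norm
  rw [mollify_apply', mollify_apply', ← integral_sub (integrable_mollify_integrand' φ hu x)
    (integrable_mollify_integrand' φ hu y), ← integral_const_mul,
    ← integral_indicator Metric.isClosed_closedBall.measurableSet, ← Real.norm_eq_abs]
  refine norm_integral_le_of_norm_le ((integrable_indicator_iff
    Metric.isClosed_closedBall.measurableSet).2 (hui.const_mul _))
    (Eventually.of_forall fun z => ?_)
  by_cases hz : z ∈ Metric.closedBall (0 : Eucl N) R
  · rw [Set.indicator_of_mem hz, ← sub_smul, norm_smul]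
    gcongr
    refine (hΛ _ _).trans_eq ?_
    rw [sub_sub_sub_cancel_right]
  · rw [Set.indicator_of_notMem hz, hzero x z hx hz, hzero y z hy hz]
    simp

lemma norm_mollify_le (φ : ContDiffBump (0 : Eucl N)) {u : Eucl N → ℝ}
    (hu : LocallyIntegrable u) {B : ℝ} (hB : ∀ x, |φ.normed volume x| ≤ B) {R : ℝ} {x : Eucl N}
    (hx : ‖x‖ + φ.rOut ≤ R) :
    |mollify φ u x| ≤ B * ∫ z in Metric.closedBall (0 : Eucl N) R, ‖u z‖ := by
  have hui : IntegrableOn (fun z => ‖u z‖) (Metric.closedBall 0 R) :=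
    (hu.integrableOn_isCompact (isCompact_closedBall 0 R)).norm
  rw [mollify_apply', ← integral_const_mul,
    ← integral_indicator Metric.isClosed_closedBall.measurableSet, ← Real.norm_eq_abs]
  refine norm_integral_le_of_norm_le ((integrable_indicator_iff
    Metric.isClosed_closedBall.measurableSet).2 (hui.const_mul _))
    (Eventually.of_forall fun z => ?_)
  by_cases hz : z ∈ Metric.closedBall (0 : Eucl N) R
  · rw [Set.indicator_of_mem hz, norm_smul]
    gcongr
    exact hB _
  · have : φ.normed volume (x - z) = 0 := by
      rw [← Function.notMem_support, ContDiffBump.support_normed_eq, mem_ball_zero_iff, not_lt]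
      rw [mem_closedBall_zero_iff, not_le] at hz
      have := norm_sub_norm_le z x
      rw [norm_sub_rev] at this
      linarith
    rw [Set.indicator_of_notMem hz, this]
    simp

lemma setIntegral_norm_le_of_eLpNorm_le {P : ℝ≥0∞} (hP : 1 ≤ P) {u : Eucl N → ℝ}
    (hu : MemLp u P volume) {C : ℝ≥0∞} (hCt : C ≠ ⊤) (hC : eLpNorm u P volume ≤ C)
    {S : Set (Eucl N)} (hS : volume S ≠ ⊤) (hS' : (1 : ℝ) - 1 / P.toReal ≥ 0) :
    ∫ z in S, ‖u z‖ ≤ (C * volume S ^ (1 - 1 / P.toReal)).toReal := by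
  have h1 := eLpNorm_le_eLpNorm_mul_rpow_measure_univ hP (hu.aestronglyMeasurable.restrict (s := S))
  rw [eLpNorm_one_eq_lintegral_enorm, Measure.restrict_apply_univ, ENNReal.toReal_one,
    div_one] at h1
  rw [integral_norm_eq_lintegral_enorm hu.aestronglyMeasurable.restrict]
  refine ENNReal.toReal_mono ?_ (h1.trans ?_)
  · exact ENNReal.mul_ne_top hCt (ENNReal.rpow_ne_top_of_nonneg hS' hS)
  · gcongr
    exact (eLpNorm_mono_measure _ Measure.restrict_le_self).trans hC

/-- Mollifications of an `L^p`-bounded sequence have finite nets for the uniform distance on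
compact sets. -/
lemma exists_finite_net_mollify {p : ℝ} (hp : 1 ≤ p) (φ : ContDiffBump (0 : Eucl N))
    {u : ℕ → Eucl N → ℝ} (hu : ∀ k, MemLp (u k) (ENNReal.ofReal p) volume) {C : ℝ≥0∞}
    (hCt : C ≠ ⊤) (hC : ∀ k, eLpNorm (u k) (ENNReal.ofReal p) volume ≤ C) {K : Set (Eucl N)}
    (hK : IsCompact K) {δ : ℝ} (hδ : 0 < δ) :
    ∃ T : Set ℕ, T.Finite ∧
      ∀ k, ∃ i ∈ T, ∀ x ∈ K, |mollify φ (u k) x - mollify φ (u i) x| ≤ δ := by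
  have hP : 1 ≤ ENNReal.ofReal p := by simpa using hp
  obtain ⟨R₀, hR₀⟩ := hK.isBounded.exists_norm_le
  set R := R₀ + φ.rOut
  set A := (C * volume (Metric.closedBall (0 : Eucl N) R) ^
    (1 - 1 / (ENNReal.ofReal p).toReal)).toReal
  have hA : ∀ k, ∫ z in Metric.closedBall (0 : Eucl N) R, ‖u k z‖ ≤ A := fun k => by
    refine setIntegral_norm_le_of_eLpNorm_le hP (hu k) hCt (hC k) measure_closedBall_lt_top.ne ?_
    rw [ENNReal.toReal_ofReal (by linarith), ge_iff_le, sub_nonneg, div_le_one (by linarith)]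
    exact hp
  obtain ⟨B, hB⟩ := φ.hasCompactSupport_normed.exists_bound_of_continuous
    (φ.continuous_normed (μ := (volume : Measure (Eucl N))))
  obtain ⟨Λ, hΛ⟩ := ContDiff.lipschitzWith_of_hasCompactSupport φ.hasCompactSupport_normed
    (φ.contDiff_normed (n := 1) (μ := (volume : Measure (Eucl N)))) one_ne_zero
  have hB0 : 0 ≤ B := (norm_nonneg _).trans (hB 0)
  refine exists_finite_net_of_lipschitz hK (M := B * A) (Λ := Λ * A) (fun k x hx => ?_)
    (fun k x hx y hy => ?_) hδ
  · refine (norm_mollify_le φ ((hu k).locallyIntegrable hP) hB (R := R)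
      (by simpa [R] using hR₀ x hx)).trans ?_
    gcongr
    exact hA k
  · refine (norm_mollify_sub_le φ ((hu k).locallyIntegrable hP) (Λ := Λ) (R := R)
      (fun x y => ?_) (by simpa [R] using hR₀ x hx) (by simpa [R] using hR₀ y hy)).trans ?_
    · simpa [Real.dist_eq, dist_eq_norm] using hΛ.dist_le_mul x y
    · rw [mul_right_comm]
      gcongr
      exact hA k

/-- The right side involves `r` and not `s`, hence is uniform over times `s` that depend on the
index of the sequence. -/
lemma eLpNorm_mollify_sub_le {p : ℝ} (hp : 1 ≤ p) {u : Eucl N → ℝ}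
    (hu : MemLp u (ENNReal.ofReal p) volume) {C : ℝ≥0∞} {r s : ℝ} (hr : 0 < r)
    (hs1 : r ^ 2 / 4 ≤ s) (hs2 : s ≤ r ^ 2) (hC : heatEnergy p s u ≤ C) :
    eLpNorm (mollify (stdBump N r hr) u - u) (ENNReal.ofReal p) volume ^ p ≤
      ENNReal.ofReal (bumpConst N * (r ^ 2) ^ (p / 2)) * C := by
  have hs : 0 < s := lt_of_lt_of_le (by positivity) hs1
  obtain ⟨u', hu'm, huu'⟩ := hu.aestronglyMeasurable
  have hu' : MemLp u' (ENNReal.ofReal p) volume := (memLp_congr_ae huu').1 hu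
  have h1 := lintegral_enorm_mollify_sub_rpow_le hp hu'm.measurable
    (hu'.locallyIntegrable (by simpa using hp)) hr hs1 hs2
  have hK : 0 ≤ bumpConst N := by unfold bumpConst; positivity
  rw [← lintegral_enorm_rpow_eq hp, mollify_congr_ae _ huu']
  refine le_trans (le_of_eq (lintegral_congr_ae ?_)) (h1.trans ?_)
  · filter_upwards [huu'] with x hx
    rw [Pi.sub_apply, hx]
  · rw [← heatEnergy_congr_ae p s huu']
    gcongr

lemma heatEnergy_sq_mul_le_of_aestronglyMeasurable {p : ℝ} (hp : 1 ≤ p) {u : Eucl N → ℝ}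
    (hu : AEStronglyMeasurable u volume) {t : ℝ} (ht : 0 < t) {m : ℕ} (hm : 0 < m) :
    heatEnergy p ((m : ℝ) ^ 2 * t) u ≤ heatEnergy p t u := by
  rw [heatEnergy_congr_ae p _ hu.ae_eq_mk, heatEnergy_congr_ae p t hu.ae_eq_mk]
  exact heatEnergy_sq_mul_le hp hu.stronglyMeasurable_mk.measurable ht hm

/-- Up to a small error uniform in large `k`, each `u k` may be replaced by its mollification at a
fixed scale `r`, and the mollifications have a finite uniform net on `K`. -/
lemma totallyBounded_range_toLp {p : ℝ} (hp : 1 ≤ p) {t : ℕ → ℝ} (ht : Infinitesimal t)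
    {u : ℕ → Eucl N → ℝ} (hu : ∀ k, MemLp (u k) (ENNReal.ofReal p) volume) {C : ℝ≥0∞}
    (hCt : C ≠ ⊤) (hC : ∀ k, eLpNorm (u k) (ENNReal.ofReal p) volume ≤ C)
    (hE : ∀ k, heatEnergy p (t k) (u k) ≤ C) {K : Set (Eucl N)} (hK : IsCompact K)
    [Fact (1 ≤ ENNReal.ofReal p)] :
    TotallyBounded (Set.range fun k => ((hu k).restrict K).toLp (u k)) := by
  have hp0 : 0 < p := by linarith
  set P := ENNReal.ofReal p
  have hP : 1 ≤ P := Fact.out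
  set f := fun k => ((hu k).restrict K).toLp (u k)
  rw [EMetric.totallyBounded_iff]
  intro ε hε
  obtain ⟨e, he0, heε⟩ : ∃ e : ℝ, 0 < e ∧ 3 * ENNReal.ofReal e < ε := by
    obtain ⟨e, he0, he⟩ := ENNReal.lt_iff_exists_nnreal_btwn.1
      (ENNReal.div_pos hε.ne' (by simp : (3 : ℝ≥0∞) ≠ ⊤))
    refine ⟨e, by exact_mod_cast he0, ?_⟩
    rw [ENNReal.lt_div_iff_mul_lt (by simp) (by simp)] at he
    simpa [mul_comm] using he
  have hep : 0 < ENNReal.ofReal e ^ p := ENNReal.rpow_pos (by simpa using he0) (by simp)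
  obtain ⟨r, hr0, hr⟩ : ∃ r : ℝ, 0 < r ∧
      ENNReal.ofReal (bumpConst N * (r ^ 2) ^ (p / 2)) * C ≤ ENNReal.ofReal e ^ p := by
    have h1 : Tendsto (fun r : ℝ => ENNReal.ofReal (bumpConst N * (r ^ 2) ^ (p / 2)) * C)
        (𝓝[>] 0) (𝓝 0) := by
      have h2 : Tendsto (fun r : ℝ => bumpConst N * (r ^ 2) ^ (p / 2)) (𝓝 0) (𝓝 0) := by
        have := (((continuous_id (X := ℝ)).tendsto 0).pow 2).rpow_const (p := p / 2)
          (Or.inr (by positivity)) |>.const_mul (bumpConst N)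
        simpa [hp0.ne'] using this
      simpa using ENNReal.Tendsto.mul_const
        (ENNReal.tendsto_ofReal (h2.mono_left nhdsWithin_le_nhds)) (Or.inr hCt)
    obtain ⟨r, hr1, hr2⟩ := ((h1.eventually (ge_mem_nhds hep)).and self_mem_nhdsWithin).exists
    exact ⟨r, hr2, hr1⟩
  set φ := stdBump N r hr0
  -- The target `r²/2` is interior to the window `[r²/4, r²]`, so `m_k² t_k` lies in the window for
  -- all `k ≥ k₀`.
  obtain ⟨hm1, hm2⟩ := tendsto_floor_sqrt_sq_mul (fun k => (ht.1 k).1) ht.2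
    (show 0 < r ^ 2 / 2 by positivity)
  obtain ⟨k₀, hk₀⟩ := eventually_atTop.1 (hm1.and (hm2.eventually (Icc_mem_nhds
    (show r ^ 2 / 4 < r ^ 2 / 2 by nlinarith [pow_pos hr0 2])
    (show r ^ 2 / 2 < r ^ 2 by nlinarith [pow_pos hr0 2]))))
  have hclose : ∀ k, k₀ ≤ k → eLpNorm (mollify φ (u k) - u k) P (volume.restrict K) ≤
      ENNReal.ofReal e := fun k hk => by
    obtain ⟨h1, h2, h3⟩ := hk₀ k hk
    refine (eLpNorm_mono_measure _ Measure.restrict_le_self).trans ?_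
    rw [← ENNReal.rpow_le_rpow_iff hp0]
    refine (eLpNorm_mollify_sub_le hp (hu k) hr0 h2 h3 ?_).trans hr
    exact (heatEnergy_sq_mul_le_of_aestronglyMeasurable hp (hu k).aestronglyMeasurable
      (ht.1 k).1 h1).trans (hE k)
  set V := volume K ^ P.toReal⁻¹ with hV
  have hVt : V ≠ ⊤ := ENNReal.rpow_ne_top_of_nonneg (by positivity) hK.measure_lt_top.ne
  set δ := e / (V.toReal + 1) with hδ
  have hδ0 : 0 < δ := by
    have : 0 ≤ V.toReal := ENNReal.toReal_nonneg
    positivity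
  have hδV : V * ENNReal.ofReal δ ≤ ENNReal.ofReal e := by
    rw [← ENNReal.ofReal_toReal hVt, ← ENNReal.ofReal_mul ENNReal.toReal_nonneg]
    refine ENNReal.ofReal_le_ofReal ?_
    have : 0 ≤ V.toReal := ENNReal.toReal_nonneg
    rw [hδ, mul_div_assoc', div_le_iff₀ (by positivity)]
    nlinarith
  obtain ⟨T, hT, hTnet⟩ := exists_finite_net_mollify hp φ (u := fun k => u (k₀ + k))
    (fun k => hu _) hCt (fun k => hC _) hK hδ0
  -- Below `k₀` the step `t_k` may be too coarse for the mollification bound; these finitely many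
  -- functions are put into the net themselves.
  refine ⟨f '' (Set.Iio k₀ ∪ (k₀ + ·) '' T),
    ((Set.finite_Iio k₀).union (hT.image _)).image f, ?_⟩
  rintro _ ⟨k, rfl⟩
  rw [Set.mem_iUnion₂]
  rcases lt_or_ge k k₀ with hk | hk
  · exact ⟨f k, Set.mem_image_of_mem f (Or.inl hk), by simpa using hε⟩
  obtain ⟨l, rfl⟩ := Nat.exists_eq_add_of_le hk
  obtain ⟨i, hiT, hi⟩ := hTnet l
  refine ⟨f (k₀ + i), Set.mem_image_of_mem f (Or.inr (Set.mem_image_of_mem _ hiT)), ?_⟩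
  change edist (f (k₀ + l)) (f (k₀ + i)) < ε
  have hgm : ∀ k, AEStronglyMeasurable (mollify φ (u k)) (volume.restrict K) := fun k =>
    (contDiff_mollify φ ((hu k).locallyIntegrable hP)).continuous.aestronglyMeasurable
  have hum : ∀ k, AEStronglyMeasurable (u k) (volume.restrict K) := fun k =>
    (hu k).aestronglyMeasurable.restrict
  have hnet : eLpNorm (mollify φ (u (k₀ + l)) - mollify φ (u (k₀ + i))) P (volume.restrict K) ≤
      ENNReal.ofReal e := by
    refine (eLpNorm_le_of_ae_bound (C := δ) ?_).trans ?_
    · filter_upwards [ae_restrict_mem hK.measurableSet] with x hx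
      exact hi x hx
    · rw [Measure.restrict_apply_univ]
      exact hδV
  have hsplit : u (k₀ + l) - u (k₀ + i) = (u (k₀ + l) - mollify φ (u (k₀ + l))) +
      (mollify φ (u (k₀ + l)) - mollify φ (u (k₀ + i))) +
      (mollify φ (u (k₀ + i)) - u (k₀ + i)) := by
    abel
  rw [Lp.edist_toLp_toLp, hsplit]
  refine lt_of_le_of_lt ?_ heε
  calc _ ≤ eLpNorm (u (k₀ + l) - mollify φ (u (k₀ + l))) P (volume.restrict K) +
        eLpNorm (mollify φ (u (k₀ + l)) - mollify φ (u (k₀ + i))) P (volume.restrict K) +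
        eLpNorm (mollify φ (u (k₀ + i)) - u (k₀ + i)) P (volume.restrict K) := by
        refine (eLpNorm_add_le (((hum _).sub (hgm _)).add ((hgm _).sub (hgm _)))
          ((hgm _).sub (hum _)) hP).trans ?_
        gcongr
        exact eLpNorm_add_le ((hum _).sub (hgm _)) ((hgm _).sub (hgm _)) hP
    _ ≤ ENNReal.ofReal e + ENNReal.ofReal e + ENNReal.ofReal e := by
        gcongr
        · rw [eLpNorm_sub_comm]
          exact hclose _ (Nat.le_add_right _ _)
        · exact hclose _ (Nat.le_add_right _ _)
    _ = 3 * ENNReal.ofReal e := by ring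

/-- The closure of a totally bounded set in the complete space `L^p(K)` is sequentially compact. -/
lemma locallyPrecompact_range {p : ℝ} (hp : 1 ≤ p) {t : ℕ → ℝ} (ht : Infinitesimal t)
    {u : ℕ → Eucl N → ℝ} (hu : ∀ k, MemLp (u k) (ENNReal.ofReal p) volume) {C : ℝ≥0∞}
    (hCt : C ≠ ⊤) (hC : ∀ k, eLpNorm (u k) (ENNReal.ofReal p) volume ≤ C)
    (hE : ∀ k, heatEnergy p (t k) (u k) ≤ C) : LocallyPrecompact p (Set.range u) := by
  intro K hK w hw
  have : Fact (1 ≤ ENNReal.ofReal p) := ⟨by simpa using hp⟩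
  choose κ hκ using hw
  have hcomp := isCompact_iff_totallyBounded_isComplete.2
    ⟨(totallyBounded_range_toLp hp ht hu hCt hC hE hK).closure, isClosed_closure.isComplete⟩
  obtain ⟨g, -, φ, hφ, hg⟩ := hcomp.tendsto_subseq (x := fun j =>
    ((hu (κ j)).restrict K).toLp (u (κ j))) fun j => subset_closure (Set.mem_range_self (κ j))
  refine ⟨φ, hφ, g, Lp.memLp g, ?_⟩
  refine (tendsto_iff_edist_tendsto_0.1 hg).congr fun j => ?_
  rw [Function.comp_apply, Lp.edist_def, ← hκ]
  exact eLpNorm_congr_ae ((MemLp.coeFn_toLp _).sub (ae_eq_refl _))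

lemma locallyPrecompactWithLimitsIn_of_bounded {p : ℝ} (hp : 1 ≤ p) {t : ℕ → ℝ}
    (ht : Infinitesimal t) {u : ℕ → Eucl N → ℝ}
    (hu : ∀ k, MemLp (u k) (ENNReal.ofReal p) volume) {C : ℝ≥0∞} (hCt : C ≠ ⊤)
    (h : ∀ k, eLpNorm (u k) (ENNReal.ofReal p) volume + heatEnergy p (t k) (u k) ≤ C) :
    LocallyPrecompactWithLimitsIn p (sobBV N p) u := by
  have hC : ∀ k, eLpNorm (u k) (ENNReal.ofReal p) volume ≤ C := fun k => le_self_add.trans (h k)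
  have hE : ∀ k, heatEnergy p (t k) (u k) ≤ C := fun k => le_add_self.trans (h k)
  refine ⟨locallyPrecompact_range hp ht hu hCt hC hE, fun φ v hφ hv => ?_⟩
  have hum : ∀ j, AEStronglyMeasurable (u (φ j)) volume := fun j => (hu _).aestronglyMeasurable
  refine (mem_sobBV_and_gradEnergy_le_liminf hp hum (hv.memLp hp hum hCt fun j => hC _) hv
    (t := fun j => t (φ j)) ⟨fun j => ht.1 _, ht.2.comp hφ.tendsto_atTop⟩ ?_).1
  exact ne_top_of_le_ne_top hCt
    (liminf_le_of_frequently_le' (Frequently.of_forall fun j => hE (φ j)))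

end HeatEnergy

end

theorem theorem1p6 (N : ℕ) (hN : 1 ≤ N) (p : ℝ) (hp : 1 ≤ p) :
    -- pointwise limit
    (∀ u ∈ sobBV N p,
      Tendsto (fun t : ℝ => heatEnergy p t u) (𝓝[>] 0)
        (𝓝 (ENNReal.ofReal (2 * Real.Gamma p / Real.Gamma (p / 2)) * gradEnergy p u))) ∧
    -- Gamma-limit with respect to the topology of L^p
    (∀ t : ℕ → ℝ, Infinitesimal t →
      GammaConvergesOn p (sobBV N p) (fun k u => heatEnergy p (t k) u)
        (fun u => ENNReal.ofReal (2 * Real.Gamma p / Real.Gamma (p / 2)) * gradEnergy p u)) ∧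
    -- coerciveness
    (∀ t : ℕ → ℝ, Infinitesimal t →
      CoerciveOn p (sobBV N p) (fun k u => heatEnergy p (t k) u)) ∧
    -- compactness of sequences bounded in L^p and in energy
    (∀ (t : ℕ → ℝ) (u : ℕ → Eucl N → ℝ), Infinitesimal t →
      (∀ k, MemLp (u k) (ENNReal.ofReal p) volume) →
      (⨆ k, (eLpNorm (u k) (ENNReal.ofReal p) volume + heatEnergy p (t k) (u k))) < ⊤ →
      LocallyPrecompactWithLimitsIn p (sobBV N p) u) ∧
    -- compactness of a subsequence under a bound on the lower limit
    (∀ (t : ℕ → ℝ) (u : ℕ → Eucl N → ℝ), Infinitesimal t →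
      (∀ k, MemLp (u k) (ENNReal.ofReal p) volume) →
      liminf (fun k => eLpNorm (u k) (ENNReal.ofReal p) volume + heatEnergy p (t k) (u k))
        atTop < ⊤ →
      ∃ φ : ℕ → ℕ, StrictMono φ ∧
        LocallyPrecompactWithLimitsIn p (sobBV N p) (fun j => u (φ j))) := by
  refine ⟨fun u hu => tendsto_heatEnergy hp hu, fun t ht => ⟨fun u v hu hv huv => ?_,
    -- The constant sequence is a recovery sequence, because no heat energy exceeds the limit
    -- energy.
    fun v hv => ⟨fun _ => v, fun _ => hv, ?_, ?_⟩⟩, fun t ht u v hu hv huv hfin => ?_,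
    fun t u ht hu hfin => ?_, fun t u ht hu hfin => ?_⟩
  · rcases eq_or_ne (liminf (fun k => heatEnergy p (t k) (u k)) atTop) ⊤ with htop | htop
    · rw [htop]
      exact le_top
    · have hvp := memLp_of_mem_sobBV hv
      exact (mem_sobBV_and_gradEnergy_le_liminf hp (fun k => (hu k).aestronglyMeasurable) hvp
        (huv.tendstoLpLoc hvp) ht htop).2
  · simp [TendstoLp]
  · exact limsup_le_of_le (by isBoundedDefault)
      (Eventually.of_forall fun k => heatEnergy_le_gradEnergy hp hv (ht.1 k).1)
  · exact (mem_sobBV_and_gradEnergy_le_liminf hp (fun k => (hu k).aestronglyMeasurable) hv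
      (huv.tendstoLpLoc hv) ht hfin.ne).1
  · exact locallyPrecompactWithLimitsIn_of_bounded hp ht hu hfin.ne fun k => le_iSup
      (fun k => eLpNorm (u k) (ENNReal.ofReal p) volume + heatEnergy p (t k) (u k)) k
  · obtain ⟨C, hC, hCt⟩ := exists_between hfin
    obtain ⟨φ, hφ, hφC⟩ := extraction_of_frequently_atTop (frequently_lt_of_liminf_lt
      (by isBoundedDefault) hC)
    exact ⟨φ, hφ, locallyPrecompactWithLimitsIn_of_bounded hp (t := fun j => t (φ j))
      ⟨fun j => ht.1 _, ht.2.comp hφ.tendsto_atTop⟩ (fun j => hu _) hCt.ne fun j => (hφC j).le⟩
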